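/- \textbf{Definitions.} Let $r\in\{0,1,2,\dots,\infty,\omega\}$ and $d\ge 1$. A \emph{g-GIET} (generalized interval exchange transformation with gaps) is a map $T:I^t\to I^b$ with $I^t=\bigsqcup_{\alpha}[a_\alpha,b_\alpha)\subset[0,1)$ and $I^b=\bigsqcup_{\alpha}[a'_\alpha,b'_\alpha)\subset[0,1)$, disjoint unions of $d$ non-empty right-open intervals, such that for each $\alpha$ the restriction of $T$ to $[a_\alpha,b_\alpha)$ is an increasing bijection onto $[a'_\alpha,b'_\alpha)$ that extends to a $C^r$-diffeomorphism $[a_\alpha,b_\alpha]\to[a'_\alpha,b'_\alpha]$ (a homeomorphism if $r=0$). It is a \emph{GIET} if $I^t=I^b=[0,1)$. The \emph{restriction} of $T$ to a finite union $J\subset I^t$ of right-open intervals is the map $T|_J:J\to T(J)$, again with top domain $J$ and bottom domain $T(J)$. For such a map $T:I^t\to I^b$, the orbit $\mathcal O(x)$ of $x$ consists of $x$ and of all $T^n(x)$, $T^{-n}(x)$, $n\ge1$, that are defined. It is \emph{periodic} if it is finite and contained in $I^t\cap I^b$; its period is its number of points. It is \emph{transient} if $T^n(x)\notin I^t$ for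 some $n\ge 0$ for which $T^n(x)$ is defined, and $T^{-m}(x)\notin I^b$ for some $m\ge0$ for which $T^{-m}(x)$ is defined. It is \emph{recurrent} if it is contained in $I^t\cap I^b$ and $x$ is an accumulation point both of the sequence $(T^n(x))_{n\ge0}$ and of the sequence $(T^{-n}(x))_{n\ge0}$ (so periodic orbits are recurrent), and \emph{non-trivially recurrent} if it is recurrent and not periodic. A \emph{quasiminimal} is the closure in $I^t$ of a non-trivially recurrent orbit. Let $\overline T$ be the map obtained by replacing the intervals $[a,b)$ of continuity of $T$ by $(a,b]$ and extending $T$ to the points $b$ by left limits. A \emph{periodic orbit at a right endpoint} of $T$ is a periodic orbit of $\overline T$ that contains the right endpoint $b$ of one of these intervals; a periodic orbit at a left endpoint is a periodic orbit of $T$ that contains a left endpoint. A finite union $J$ of right-open intervals is a \emph{domain of transition} if the orbit under $T|_J$ of every $x\in J$ is transient, and a \emph{domain of recurrence} if the orbit under $T|_J$ of no $x\in J$ is transient. \textbf{Theorem (Decomposition theorem).} For every GIET $T:[0,1)\to[0,1)$ there exist $k\ge 0$ and a partition $$[0,1)=D\sqcup R_1\sqcup\dots\sqcup R_k$$ into finite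 unions of right-open intervals ($D$ possibly empty) such that $D$ is a domain of transition, each $R_i$ is a domain of recurrence, and for each $i$ exactly one of the following holds for the restriction $T|_{R_i}$: \begin{enumerate} \item (periodic domain) there is $p\ge1$ such that $T|_{R_i}$ has a periodic orbit of period $p$, possibly at a (left or right) endpoint, and all recurrent orbits of $T|_{R_i}$ are periodic of period $p$; \item (quasiminimal domain) $T|_{R_i}$ has a unique quasiminimal, and all recurrent orbits of $T|_{R_i}$ are non-trivially recurrent. \end{enumerate} -/

import Mathlib

open Set Filter Topology Function

/-- A partially defined map of the real line: `toFun` is only meaningful on `dom`. -/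
structure PMap where
  dom : Set ℝ
  toFun : ℝ → ℝ

namespace PMap

/-- The image of the map; for a g-GIET this is `I^b`, and `dom` is `I^t`. -/
def range (T : PMap) : Set ℝ := T.toFun '' T.dom

/-- The restriction `T|_J : J → T(J)`. -/
def restrict (T : PMap) (J : Set ℝ) : PMap := ⟨T.dom ∩ J, T.toFun⟩

/-- The domain of definition of the `n`-th iterate. -/
def domIter (T : PMap) (n : ℕ) : Set ℝ := {x | ∀ k < n, T.toFun^[k] x ∈ T.dom}

def forwardOrbit (T : PMap) (x : ℝ) : Set ℝ :=
  {y | ∃ n, x ∈ T.domIter n ∧ T.toFun^[n] x = y}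

/-- The points `y = T^{-n}(x)`, `n ≥ 0`, for an injective map. -/
def backwardOrbit (T : PMap) (x : ℝ) : Set ℝ :=
  {y | ∃ n, y ∈ T.domIter n ∧ T.toFun^[n] y = x}

def orbit (T : PMap) (x : ℝ) : Set ℝ := T.forwardOrbit x ∪ T.backwardOrbit x

/-- A periodic orbit: a finite orbit contained in `I^t ∩ I^b`. -/
def IsPeriodic (T : PMap) (x : ℝ) : Prop :=
  T.orbit x ⊆ T.dom ∩ T.range ∧ (T.orbit x).Finite

/-- The orbit of `x` is periodic, of (least) period `p`. -/
def IsPeriodicOfPeriod (T : PMap) (p : ℕ) (x : ℝ) : Prop :=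
  T.IsPeriodic x ∧ (T.orbit x).ncard = p

/-- The orbit of `x` escapes in the future into a top gap (the complement of `dom`) and in the
past into a bottom gap (the complement of `range`). -/
def IsTransient (T : PMap) (x : ℝ) : Prop :=
  (∃ n, x ∈ T.domIter n ∧ T.toFun^[n] x ∉ T.dom) ∧
  (∃ n y, y ∈ T.domIter n ∧ T.toFun^[n] y = x ∧ y ∉ T.range)

/-- Accumulation points in `I^t` of the sequence `T^n(x)`, `n → ∞`. On infinite orbits of an
injective map they are the accumulation points of the set `forwardOrbit`; a periodic orbit is
its own limit set. -/
def omegaLimit (T : PMap) (x : ℝ) : Set ℝ :=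
  {y | y ∈ T.dom ∧ ∀ U ∈ 𝓝 y, ∀ N : ℕ, ∃ n ≥ N, x ∈ T.domIter n ∧ T.toFun^[n] x ∈ U}

/-- Accumulation points in `I^t` of the sequence `T^{-n}(x)`, `n → ∞`. -/
def alphaLimit (T : PMap) (x : ℝ) : Set ℝ :=
  {y | y ∈ T.dom ∧ ∀ U ∈ 𝓝 y, ∀ N : ℕ, ∃ n ≥ N, ∃ z ∈ U, z ∈ T.domIter n ∧ T.toFun^[n] z = x}

/-- The orbit of `x` is recurrent, both in the future and in the past. -/
def IsRecurrent (T : PMap) (x : ℝ) : Prop :=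
  (T.forwardOrbit x ⊆ T.dom ∩ T.range ∧ x ∈ T.omegaLimit x) ∧
  (T.backwardOrbit x ⊆ T.dom ∩ T.range ∧ x ∈ T.alphaLimit x)

def IsNontriviallyRecurrent (T : PMap) (x : ℝ) : Prop := T.IsRecurrent x ∧ ¬ T.IsPeriodic x

/-- A quasiminimal: the closure in `I^t` of a non-trivially recurrent orbit. -/
def IsQuasiminimal (T : PMap) (Ω : Set ℝ) : Prop :=
  ∃ x, T.IsNontriviallyRecurrent x ∧ Ω = T.dom ∩ closure (T.orbit x)

/-- The left-open version of `T`: if `dom` is the union of intervals `[a, b)`, then the new domain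
is the union of the intervals `(a, b]`, and the map is extended by continuity from the left. -/
noncomputable def leftOpen (T : PMap) : PMap :=
  ⟨{y | ∀ᶠ z in 𝓝[<] y, z ∈ T.dom}, leftLim T.toFun⟩

/-- `y` is the right endpoint of an interval of continuity of `T`. -/
def IsRightEndpoint (T : PMap) (y : ℝ) : Prop :=
  y ∈ T.leftOpen.dom ∧ ¬ (T.dom ∈ 𝓝 y ∧ ContinuousAt T.toFun y)

/-- `y` lies on a periodic orbit, of period `p`, at a right endpoint of `T`. -/
def IsPeriodicAtRightEndpoint (T : PMap) (p : ℕ) (y : ℝ) : Prop :=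
  T.leftOpen.IsPeriodicOfPeriod p y ∧ ∃ z ∈ T.leftOpen.orbit y, T.IsRightEndpoint z

/-- There is a periodic orbit, possibly at an endpoint (periodic orbits at left endpoints are
periodic orbits of `T` itself), and all recurrent orbits are periodic of the same period. -/
def IsPeriodicType (T : PMap) : Prop :=
  ∃ p : ℕ, ((∃ x, T.IsPeriodicOfPeriod p x) ∨ (∃ y, T.IsPeriodicAtRightEndpoint p y)) ∧
    ∀ x, T.IsRecurrent x → T.IsPeriodicOfPeriod p x

/-- There is a unique quasiminimal and all recurrent orbits are non-trivially recurrent. -/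
def IsQuasiminimalType (T : PMap) : Prop :=
  (∃! Ω, T.IsQuasiminimal Ω) ∧ ∀ x, T.IsRecurrent x → T.IsNontriviallyRecurrent x

/-- Every orbit of the restriction of `T` to `J` is transient. -/
def IsDomainOfTransition (T : PMap) (J : Set ℝ) : Prop :=
  ∀ x ∈ J, (T.restrict J).IsTransient x

/-- No orbit of the restriction of `T` to `J` is transient. -/
def IsDomainOfRecurrence (T : PMap) (J : Set ℝ) : Prop :=
  ∀ x ∈ J, ¬ (T.restrict J).IsTransient x

end PMap

/-- A `C^r` generalized interval exchange transformation with gaps, of `d` intervals: the top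
interval `[topL α, topR α)` is mapped onto the bottom interval `[botL α, botR α)` by an
orientation preserving `C^r` diffeomorphism `g` which extends to the closures (with inverse `h`). -/
structure GGIET (r : WithTop ℕ∞) (d : ℕ) where
  topL : Fin d → ℝ
  topR : Fin d → ℝ
  botL : Fin d → ℝ
  botR : Fin d → ℝ
  toFun : ℝ → ℝ
  top_lt : ∀ α, topL α < topR α
  bot_lt : ∀ α, botL α < botR α
  top_subset : ∀ α, Ico (topL α) (topR α) ⊆ Ico 0 1
  bot_subset : ∀ α, Ico (botL α) (botR α) ⊆ Ico 0 1
  top_disjoint : Pairwise fun α β => Disjoint (Ico (topL α) (topR α)) (Ico (topL β) (topR β))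
  bot_disjoint : Pairwise fun α β => Disjoint (Ico (botL α) (botR α)) (Ico (botL β) (botR β))
  branch : ∀ α, ∃ g h : ℝ → ℝ,
    MapsTo g (Icc (topL α) (topR α)) (Icc (botL α) (botR α)) ∧
    MapsTo h (Icc (botL α) (botR α)) (Icc (topL α) (topR α)) ∧
    InvOn h g (Icc (topL α) (topR α)) (Icc (botL α) (botR α)) ∧
    StrictMonoOn g (Icc (topL α) (topR α)) ∧
    ContDiffOn ℝ r g (Icc (topL α) (topR α)) ∧
    ContDiffOn ℝ r h (Icc (botL α) (botR α)) ∧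
    EqOn toFun g (Ico (topL α) (topR α))

namespace GGIET

/-- The domain `I^t`. -/
def top {r : WithTop ℕ∞} {d : ℕ} (T : GGIET r d) : Set ℝ := ⋃ α, Ico (T.topL α) (T.topR α)

/-- The image `I^b`. -/
def bot {r : WithTop ℕ∞} {d : ℕ} (T : GGIET r d) : Set ℝ := ⋃ α, Ico (T.botL α) (T.botR α)

/-- A generalized interval exchange transformation: a g-GIET without gaps. -/
def IsGIET {r : WithTop ℕ∞} {d : ℕ} (T : GGIET r d) : Prop :=
  T.top = Ico 0 1 ∧ T.bot = Ico 0 1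

def toPMap {r : WithTop ℕ∞} {d : ℕ} (T : GGIET r d) : PMap := ⟨T.top, T.toFun⟩

end GGIET

/-- A finite union of right-open intervals. -/
def IsRightOpenUnion (S : Set ℝ) : Prop :=
  ∃ s : Finset (ℝ × ℝ), S = ⋃ q ∈ s, Ico q.1 q.2

/-!
A generalized interval exchange transformation lifts to a homeomorphism of a compact ordered space,
the double arrow space, in which every point of `(0, 1)` is split into a left and a right copy. The
lift preserves the order locally, and the finite unions of right-open intervals correspond to the
clopen sets.

By compactness every orbit accumulates, in the future, on a periodic orbit or on an aperiodic
minimal set. The points of a given period have a clopen neighbourhood each of whose points stays in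
it in the future or in the past and accumulates there on such points only: near a fixed point of an
increasing map, one-sided neighbourhoods are mapped into themselves by the map or by its inverse.
For an aperiodic minimal set `M`, such a neighbourhood is obtained by removing finitely many of the
gaps of `M`: all but finitely many gaps are mapped onto gaps, and a gap which is mapped onto gaps
for ever shrinks onto `M`. By compactness finitely many of these neighbourhoods are visited by all
orbits, in the future and in the past; made disjoint and projected back to `[0, 1)`, they are the
domains of recurrence, and what remains is the domain of transition.
-/

namespace OrderedDynamics

section Iterates

variable {X : Type*} {f g : X → X} {x : X}

lemma iterate_leftInverse_of_le (h : LeftInverse g f) {m n : ℕ} (hmn : m ≤ n) (x : X) :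
    g^[m] (f^[n] x) = f^[n - m] x := by
  conv_lhs => rw [← Nat.add_sub_cancel' hmn, iterate_add_apply, h.iterate m]

lemma iterate_leftInverse_of_ge (h : LeftInverse g f) {m n : ℕ} (hnm : n ≤ m) (x : X) :
    g^[m] (f^[n] x) = g^[m - n] x := by
  conv_lhs => rw [← Nat.sub_add_cancel hnm, iterate_add_apply, h.iterate n]

lemma isPeriodicPt_of_leftInverse (h : LeftInverse g f) {n : ℕ} (hx : IsPeriodicPt f n x) :
    IsPeriodicPt g n x := by
  have hgn := h.iterate n x
  rwa [hx.eq] at hgn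

lemma minimalPeriod_of_inverse (hgf : LeftInverse g f) (hfg : LeftInverse f g) (x : X) :
    minimalPeriod g x = minimalPeriod f x :=
  Nat.dvd_antisymm
    (isPeriodicPt_of_leftInverse hgf (isPeriodicPt_minimalPeriod f x)).minimalPeriod_dvd
    (isPeriodicPt_of_leftInverse hfg (isPeriodicPt_minimalPeriod g x)).minimalPeriod_dvd

lemma iterate_injective_of_notMem_periodicPts (hf : Injective f) (hx : x ∉ periodicPts f) :
    Injective fun n => f^[n] x := by
  intro m n heq
  by_contra hmn
  wlog hlt : m < n generalizing m n
  · exact this heq.symm (Ne.symm hmn) (by omega)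
  · exact hx ⟨n - m, Nat.sub_pos_of_lt hlt, iterate_cancel hf heq.symm⟩

lemma range_iterate_subset_of_leftInverse (h : LeftInverse g f) (hx : x ∈ periodicPts f) :
    range (fun n => g^[n] x) ⊆ range fun n => f^[n] x := by
  obtain ⟨q, hq, hqx⟩ := hx
  rintro _ ⟨n, rfl⟩
  refine ⟨q * n - n, ?_⟩
  beta_reduce
  rw [← iterate_leftInverse_of_le h (Nat.le_mul_of_pos_left n hq), (hqx.mul_const n).eq]

lemma range_iterate_eq_image_Iio (hx : x ∈ periodicPts f) :
    range (fun n => f^[n] x) = (fun n => f^[n] x) '' Iio (minimalPeriod f x) := by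
  refine Subset.antisymm (range_subset_iff.2 fun n => ?_) (image_subset_range _ _)
  exact ⟨n % minimalPeriod f x, Nat.mod_lt n (minimalPeriod_pos_of_mem_periodicPts hx),
    iterate_mod_minimalPeriod_eq⟩

lemma iterate_mul_mem {s : Set X} {q : ℕ} (hmap : MapsTo f^[q] s s) (hx : x ∈ s) (k : ℕ) :
    f^[q * k] x ∈ s := by
  rw [iterate_mul]
  exact hmap.iterate k hx

lemma finite_setOf_visits_before_and_after {S : Set X} (hgf : LeftInverse g f)
    (hfg : LeftInverse f g) (hS : S.Finite) (hap : ∀ x ∈ S, x ∉ periodicPts f) :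
    {x | (∃ n, f^[n] x ∈ S) ∧ ∃ n, g^[n] x ∈ S}.Finite := by
  have hbdd : ∀ y ∈ S, BddAbove {n : ℕ | f^[n] y ∈ S} := fun y hy =>
    (hS.preimage (f := fun n => f^[n] y)
      (iterate_injective_of_notMem_periodicPts hgf.injective (hap y hy)).injOn).bddAbove
  choose! N hN using hbdd
  refine (hS.biUnion fun y _ => (finite_Iic (N y)).image fun n => f^[n] y).subset ?_
  rintro x ⟨⟨n, hn⟩, m, hm⟩
  have hx : f^[m] (g^[m] x) = x := hfg.iterate m x
  have hnm : f^[n + m] (g^[m] x) ∈ S := by rwa [iterate_add_apply, hx]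
  exact mem_biUnion hm ⟨m, (Nat.le_add_left m n).trans (hN _ hm hnm), hx⟩

lemma monotone_iterate_of_mapsTo [Preorder X] {s : Set X} (hf : MonotoneOn f s)
    (hs : MapsTo f s s) (hx : x ∈ s) (hle : x ≤ f x) : Monotone fun n => f^[n] x := by
  refine monotone_nat_of_le_succ fun n => ?_
  induction n with
  | zero => exact hle
  | succ n ih =>
    simp only [iterate_succ_apply' f] at ih ⊢
    exact hf (hs.iterate n hx) (hs (hs.iterate n hx)) ih

lemma antitone_iterate_of_mapsTo [Preorder X] {s : Set X} (hf : MonotoneOn f s)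
    (hs : MapsTo f s s) (hx : x ∈ s) (hle : f x ≤ x) : Antitone fun n => f^[n] x :=
  monotone_iterate_of_mapsTo (X := Xᵒᵈ) hf.dual hs hx hle

end Iterates

section LimitSets

variable {X : Type*} [TopologicalSpace X] {f : X → X} {C : Set X} {x w : X} {q : ℕ}

/-- The set of accumulation points of the sequence of iterates `f^[n] x`. The limit set in the past
under a homeomorphism `T` is `omegaSet T.symm x`. -/
def omegaSet (f : X → X) (x : X) : Set X := omegaLimit atTop (fun n y => f^[n] y) {x}

lemma mem_omegaSet_iff_mapClusterPt :
    w ∈ omegaSet f x ↔ MapClusterPt w atTop fun n => f^[n] x :=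
  mem_omegaLimit_singleton_iff_mapClusterPt ..

lemma exists_mem_omegaSet_iff {Y : Type*} [TopologicalSpace Y] {v : X → Y} (hv : IsProperMap v)
    {y : Y} : (∃ w, v w = y ∧ w ∈ omegaSet f x) ↔ MapClusterPt y atTop fun n => v (f^[n] x) := by
  simp only [mem_omegaSet_iff_mapClusterPt]
  constructor
  · rintro ⟨w, rfl, hw⟩
    exact hw.continuousAt_comp hv.continuous.continuousAt
  · exact fun hy => hv.clusterPt_of_mapClusterPt hy

lemma mem_omegaSet_iff :
    w ∈ omegaSet f x ↔ ∀ U ∈ 𝓝 w, ∀ N : ℕ, ∃ n ≥ N, f^[n] x ∈ U := by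
  simp only [mem_omegaSet_iff_mapClusterPt, mapClusterPt_iff_frequently, frequently_atTop]

lemma exists_iterate_mem_of_mem_omegaSet (hw : w ∈ omegaSet f x) {U : Set X} (hU : U ∈ 𝓝 w) :
    ∃ n, f^[n] x ∈ U :=
  let ⟨n, _, hn⟩ := mem_omegaSet_iff.1 hw U hU 0
  ⟨n, hn⟩

lemma isClosed_omegaSet : IsClosed (omegaSet f x) := isClosed_omegaLimit ..

lemma omegaSet_nonempty [CompactSpace X] : (omegaSet f x).Nonempty :=
  nonempty_omegaLimit _ _ _ (singleton_nonempty x)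

lemma mapsTo_omegaSet (hf : Continuous f) : MapsTo f (omegaSet f x) (omegaSet f x) := by
  intro w hw
  rw [mem_omegaSet_iff] at hw ⊢
  intro U hU N
  obtain ⟨n, hn, hx⟩ := hw _ (hf.continuousAt hU) N
  exact ⟨n + 1, by omega, by rwa [iterate_succ_apply']⟩

lemma mapsTo_symm_omegaSet (T : X ≃ₜ X) (x : X) :
    MapsTo T.symm (omegaSet T x) (omegaSet T x) := by
  intro w hw
  rw [mem_omegaSet_iff] at hw ⊢
  intro U hU N
  obtain ⟨n, hn, hx⟩ := hw _ (T.symm.continuous.continuousAt hU) (N + 1)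
  obtain ⟨m, rfl⟩ := Nat.exists_eq_add_of_le' (show 1 ≤ n by omega)
  exact ⟨m, by omega, by rwa [mem_preimage, iterate_succ_apply', T.symm_apply_apply] at hx⟩

lemma omegaSet_iterate_apply (f : X → X) (k : ℕ) (x : X) :
    omegaSet f (f^[k] x) = omegaSet f x := by
  ext w
  have hshift : map (fun n => f^[n] (f^[k] x)) atTop = map (fun n => f^[n] x) atTop := by
    conv_rhs => rw [← map_add_atTop_eq_nat k, map_map]
    simp only [comp_def, iterate_add_apply]
  simp only [mem_omegaSet_iff_mapClusterPt, MapClusterPt, hshift]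

lemma omegaSet_subset_of_forall_mem (hC : IsClosed C) (h : ∀ n, f^[n] x ∈ C) :
    omegaSet f x ⊆ C := fun _ hw =>
  hC.mem_of_mapClusterPt (mem_omegaSet_iff_mapClusterPt.1 hw) (Eventually.of_forall h)

lemma mem_omegaSet_self_of_isPeriodicPt (hq : 0 < q) (hx : IsPeriodicPt f q x) :
    x ∈ omegaSet f x :=
  mem_omegaSet_iff.2 fun _ hU N =>
    ⟨q * N, Nat.le_mul_of_pos_left N hq, (hx.mul_const N).eq.symm ▸ mem_of_mem_nhds hU⟩

lemma omegaSet_subset_setOf_minimalPeriod_eq [T1Space X] (hx : x ∈ periodicPts f) :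
    omegaSet f x ⊆ {y | minimalPeriod f y = minimalPeriod f x} := by
  have hsub : omegaSet f x ⊆ (fun n => f^[n] x) '' Iio (minimalPeriod f x) :=
    omegaSet_subset_of_forall_mem ((finite_Iio _).image _).isClosed fun n =>
      (range_iterate_eq_image_Iio hx).le ⟨n, rfl⟩
  intro y hy
  obtain ⟨n, -, rfl⟩ := hsub hy
  exact minimalPeriod_apply_iterate hx n

lemma mem_omegaSet_iterate_of_forall_dvd {N : Set X} (hN : N ∈ 𝓝 w) (hq : 0 < q)
    (hdvd : ∀ n, f^[n] x ∈ N → q ∣ n) (hw : w ∈ omegaSet f x) : w ∈ omegaSet f^[q] x := by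
  rw [mem_omegaSet_iff] at hw ⊢
  intro U hU k
  obtain ⟨n, hn, hnU, hnN⟩ := hw _ (inter_mem hU hN) (q * k)
  obtain ⟨l, rfl⟩ := hdvd n hnN
  exact ⟨l, Nat.le_of_mul_le_mul_left hn hq, by rwa [← iterate_mul]⟩

lemma exists_finset_forall_exists_iterate_mem [CompactSpace X] (hf : Continuous f) {ι : Type*}
    {I : Set ι} {R : ι → Set X} (hR : ∀ i ∈ I, IsOpen (R i))
    (hω : ∀ x, ∃ i ∈ I, (omegaSet f x ∩ R i).Nonempty) :
    ∃ t : Finset ι, ↑t ⊆ I ∧ ∀ x, ∃ i ∈ t, ∃ n, f^[n] x ∈ R i := by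
  classical
  have hvisit : ∀ x, ∃ i ∈ I, ∃ n, f^[n] x ∈ R i := fun x =>
    let ⟨i, hi, _, hw, hwi⟩ := hω x
    ⟨i, hi, exists_iterate_mem_of_mem_omegaSet hw ((hR i hi).mem_nhds hwi)⟩
  choose i hi n hn using hvisit
  obtain ⟨t, ht⟩ := isCompact_univ.elim_finite_subcover (fun x => f^[n x] ⁻¹' R (i x))
    (fun x => (hR _ (hi x)).preimage (hf.iterate _)) fun x _ => mem_iUnion.2 ⟨x, hn x⟩
  refine ⟨t.image i, by simpa [subset_def] using fun x _ => hi x, fun x => ?_⟩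
  obtain ⟨y, hy, hxy⟩ := mem_iUnion₂.1 (ht (mem_univ x))
  exact ⟨i y, Finset.mem_image_of_mem i hy, n y, hxy⟩

end LimitSets

section MinimalSets

variable {X : Type*} [TopologicalSpace X] {f : X → X} {M M' : Set X} {x : X}

/-- `M` is a minimal set of `f`: it is minimal among the nonempty closed sets that `f` maps into
themselves. -/
def IsMinimalSet (f : X → X) (M : Set X) : Prop :=
  Minimal (fun A => A.Nonempty ∧ IsClosed A ∧ MapsTo f A A) M

lemma exists_isMinimalSet_subset [CompactSpace X] {A : Set X} (hne : A.Nonempty)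
    (hcl : IsClosed A) (hA : MapsTo f A A) : ∃ M ⊆ A, IsMinimalSet f M := by
  refine zorn_superset_nonempty {B : Set X | B.Nonempty ∧ IsClosed B ∧ MapsTo f B B}
    (fun c hc hchain hcne => ⟨⋂₀ c, ⟨?_, isClosed_sInter fun B hB => (hc hB).2.1,
      fun x hx B hB => (hc hB).2.2 (hx B hB)⟩, fun s hs => sInter_subset_of_mem hs⟩)
    A ⟨hne, hcl, hA⟩
  have := hcne.to_subtype
  exact IsCompact.nonempty_sInter_of_directed_nonempty_isCompact_isClosed
    (fun A hA B hB => (hchain.total hA hB).elim (fun h => ⟨A, hA, Subset.rfl, h⟩)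
      fun h => ⟨B, hB, h, Subset.rfl⟩) (fun B hB => (hc hB).1) (fun B hB => (hc hB).2.1.isCompact)
    fun B hB => (hc hB).2.1

namespace IsMinimalSet

lemma nonempty (hM : IsMinimalSet f M) : M.Nonempty := hM.prop.1

lemma isClosed (hM : IsMinimalSet f M) : IsClosed M := hM.prop.2.1

lemma mapsTo (hM : IsMinimalSet f M) : MapsTo f M M := hM.prop.2.2

variable [CompactSpace X]

lemma omegaSet_eq (hM : IsMinimalSet f M) (hf : Continuous f) (hx : x ∈ M) : omegaSet f x = M :=
  hM.eq_of_subset ⟨omegaSet_nonempty, isClosed_omegaSet, mapsTo_omegaSet hf⟩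
    (omegaSet_subset_of_forall_mem hM.isClosed fun n => hM.mapsTo.iterate n hx)

lemma eq_of_mem_of_mem (hM : IsMinimalSet f M) (hM' : IsMinimalSet f M') (hf : Continuous f)
    (hx : x ∈ M) (hx' : x ∈ M') : M = M' := by
  rw [← hM.omegaSet_eq hf hx, hM'.omegaSet_eq hf hx']

lemma mapsTo_symm {T : X ≃ₜ X} (hM : IsMinimalSet T M) : MapsTo T.symm M M := by
  intro x hx
  rw [← hM.omegaSet_eq T.continuous hx]
  exact mapsTo_symm_omegaSet T x (by rwa [hM.omegaSet_eq T.continuous hx])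

lemma symm {T : X ≃ₜ X} (hM : IsMinimalSet T M) : IsMinimalSet T.symm M := by
  refine ⟨⟨hM.nonempty, hM.isClosed, hM.mapsTo_symm⟩, ?_⟩
  rintro A ⟨⟨x, hx⟩, hcl, hA⟩ hAM
  have hsub : omegaSet T.symm x ⊆ A :=
    omegaSet_subset_of_forall_mem hcl fun n => hA.iterate n hx
  have heq : omegaSet T.symm x = M := hM.eq_of_subset
    ⟨omegaSet_nonempty, isClosed_omegaSet, mapsTo_symm_omegaSet T.symm x⟩ (hsub.trans hAM)
  exact heq.ge.trans hsub

lemma closure_orbit_eq {T : X ≃ₜ X} (hM : IsMinimalSet T M) (hx : x ∈ M) :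
    closure (range (fun n => T^[n] x) ∪ range fun n => T.symm^[n] x) = M := by
  refine Subset.antisymm (closure_minimal (union_subset ?_ ?_) hM.isClosed) ?_
  · exact range_subset_iff.2 fun n => hM.mapsTo.iterate n hx
  · exact range_subset_iff.2 fun n => hM.mapsTo_symm.iterate n hx
  · exact (hM.omegaSet_eq T.continuous hx).ge.trans
      (omegaSet_subset_of_forall_mem isClosed_closure fun n => subset_closure (.inl ⟨n, rfl⟩))

end IsMinimalSet

/-- `M` is a minimal set of `f` without periodic points. -/
structure IsAperiodicMinimal (f : X → X) (M : Set X) : Prop where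
  isMinimalSet : IsMinimalSet f M
  notMem_periodicPts : ∀ x ∈ M, x ∉ periodicPts f

namespace IsAperiodicMinimal

variable [CompactSpace X]

lemma symm {T : X ≃ₜ X} (hM : IsAperiodicMinimal T M) : IsAperiodicMinimal T.symm M where
  isMinimalSet := hM.isMinimalSet.symm
  notMem_periodicPts := fun x hx ⟨n, hn, h⟩ =>
    hM.notMem_periodicPts x hx ⟨n, hn, isPeriodicPt_of_leftInverse T.apply_symm_apply h⟩

lemma preperfect (hM : IsAperiodicMinimal f M) (hf : Continuous f) : Preperfect M := by
  intro x hx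
  rw [accPt_iff_nhds]
  intro U hU
  have hxx : x ∈ omegaSet f x := by rwa [hM.isMinimalSet.omegaSet_eq hf hx]
  obtain ⟨n, hn, hxn⟩ := mem_omegaSet_iff.1 hxx U hU 1
  exact ⟨_, ⟨hxn, hM.isMinimalSet.mapsTo.iterate n hx⟩,
    fun heq => hM.notMem_periodicPts x hx ⟨n, hn, heq⟩⟩

end IsAperiodicMinimal

end MinimalSets

section RecurrenceClasses

variable {X : Type*} [TopologicalSpace X] {C C' : Set X} {x : X}

/-- The sets on which orbits accumulate: the set of all points of a given period, and the aperiodic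
minimal sets. -/
inductive IsRecurrenceClass (f : X → X) : Set X → Prop
  | periodic {q : ℕ} (hq : 0 < q) (hne : {x | minimalPeriod f x = q}.Nonempty) :
    IsRecurrenceClass f {x | minimalPeriod f x = q}
  | aperiodic {M : Set X} (hM : IsAperiodicMinimal f M) : IsRecurrenceClass f M

lemma exists_isRecurrenceClass_inter_omegaSet [CompactSpace X] {f : X → X} (hf : Continuous f)
    (x : X) : ∃ C, IsRecurrenceClass f C ∧ (omegaSet f x ∩ C).Nonempty := by
  obtain ⟨M, hMx, hM⟩ :=
    exists_isMinimalSet_subset omegaSet_nonempty isClosed_omegaSet (mapsTo_omegaSet (x := x) hf)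
  by_cases hap : ∀ y ∈ M, y ∉ periodicPts f
  · obtain ⟨y, hy⟩ := hM.nonempty
    exact ⟨M, .aperiodic ⟨hM, hap⟩, y, hMx hy, hy⟩
  · push Not at hap
    obtain ⟨y, hy, hper⟩ := hap
    exact ⟨_, .periodic (minimalPeriod_pos_of_mem_periodicPts hper) ⟨y, rfl⟩, y, hMx hy, rfl⟩

lemma exists_finset_isRecurrenceClass [CompactSpace X] {f : X → X} (hf : Continuous f)
    {R : Set X → Set X} (hR : ∀ C, IsRecurrenceClass f C → IsOpen (R C))
    (hCR : ∀ C, IsRecurrenceClass f C → C ⊆ R C) :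
    ∃ t : Finset (Set X), (∀ C ∈ t, IsRecurrenceClass f C) ∧ ∀ x, ∃ C ∈ t, ∃ n, f^[n] x ∈ R C :=
  exists_finset_forall_exists_iterate_mem hf (I := Set.ofPred (IsRecurrenceClass f)) hR fun x =>
    let ⟨C, hC, hne⟩ := exists_isRecurrenceClass_inter_omegaSet hf x
    ⟨C, hC, hne.mono (inter_subset_inter_right _ (hCR C hC))⟩

namespace IsRecurrenceClass

lemma nonempty {f : X → X} (hC : IsRecurrenceClass f C) : C.Nonempty := by
  cases hC with
  | periodic _ hne => exact hne
  | aperiodic hM => exact hM.isMinimalSet.nonempty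

variable [CompactSpace X]

lemma eq_of_mem_of_mem {f : X → X} (hf : Continuous f) (hC : IsRecurrenceClass f C)
    (hC' : IsRecurrenceClass f C') (hx : x ∈ C) (hx' : x ∈ C') : C = C' := by
  cases hC with
  | periodic hq _ =>
    cases hC' with
    | periodic => rw [← hx.symm.trans hx']
    | aperiodic hM' =>
      exact (hM'.notMem_periodicPts x hx'
        (minimalPeriod_pos_iff_mem_periodicPts.1 (hq.trans_eq hx.symm))).elim
  | aperiodic hM =>
    cases hC' with
    | periodic hq' _ =>
      exact (hM.notMem_periodicPts x hx
        (minimalPeriod_pos_iff_mem_periodicPts.1 (hq'.trans_eq hx'.symm))).elim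
    | aperiodic hM' => exact hM.isMinimalSet.eq_of_mem_of_mem hM'.isMinimalSet hf hx hx'

lemma omegaSet_subset [T1Space X] {f : X → X} (hf : Continuous f) (hC : IsRecurrenceClass f C)
    (hx : x ∈ C) : omegaSet f x ⊆ C := by
  cases hC with
  | periodic hq _ =>
    have hsub := omegaSet_subset_setOf_minimalPeriod_eq
      (minimalPeriod_pos_iff_mem_periodicPts.1 (hq.trans_eq hx.symm))
    rwa [show minimalPeriod f x = _ from hx] at hsub
  | aperiodic hM => exact (hM.isMinimalSet.omegaSet_eq hf hx).le

lemma symm {T : X ≃ₜ X} (hC : IsRecurrenceClass T C) : IsRecurrenceClass T.symm C := by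
  cases hC with
  | periodic hq hne =>
    simp only [← minimalPeriod_of_inverse T.symm_apply_apply T.apply_symm_apply] at hne ⊢
    exact .periodic hq hne
  | aperiodic hM => exact .aperiodic hM.symm

end IsRecurrenceClass

end RecurrenceClasses

section RecurrenceRegions

variable {X : Type*} [TopologicalSpace X] {T : X ≃ₜ X} {R R' C C' : Set X} {x : X}

/-- `R` is a clopen set each of whose points stays in `R` for all positive or for all negative
times, and accumulates in that time direction only on `C`. -/
structure IsRecurrenceRegion (T : X ≃ₜ X) (R C : Set X) : Prop where
  isClopen : IsClopen R
  stays : ∀ x ∈ R, ((∀ n, T^[n] x ∈ R) ∧ omegaSet T x ⊆ C) ∨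
    ((∀ n, T.symm^[n] x ∈ R) ∧ omegaSet T.symm x ⊆ C)

namespace IsRecurrenceRegion

lemma symm (h : IsRecurrenceRegion T R C) : IsRecurrenceRegion T.symm R C :=
  ⟨h.isClopen, fun x hx => (h.stays x hx).symm⟩

lemma biUnion {ι : Type*} {s : Set ι} (hs : s.Finite) {R : ι → Set X}
    (h : ∀ i ∈ s, IsRecurrenceRegion T (R i) C) : IsRecurrenceRegion T (⋃ i ∈ s, R i) C where
  isClopen := hs.isClopen_biUnion fun i hi => (h i hi).isClopen
  stays := by
    intro x hx
    obtain ⟨i, hi, hxi⟩ := mem_iUnion₂.1 hx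
    exact ((h i hi).stays x hxi).imp (fun hf => ⟨fun n => mem_biUnion hi (hf.1 n), hf.2⟩)
      fun hb => ⟨fun n => mem_biUnion hi (hb.1 n), hb.2⟩

lemma mem_of_isPeriodicPt {q : ℕ} (h : IsRecurrenceRegion T R C) (hq : 0 < q)
    (hx : IsPeriodicPt T q x) (hxR : x ∈ R) : x ∈ C :=
  (h.stays x hxR).elim (fun hf => hf.2 (mem_omegaSet_self_of_isPeriodicPt hq hx))
    fun hb => hb.2 (mem_omegaSet_self_of_isPeriodicPt hq
      (isPeriodicPt_of_leftInverse T.symm_apply_apply hx))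

variable [CompactSpace X]

lemma iterate_notMem (h : IsRecurrenceRegion T R C) (hC : Disjoint C' C) (hx : x ∉ R)
    (hω : omegaSet T x ⊆ C') (n : ℕ) : T^[n] x ∉ R := by
  intro hn
  rcases h.stays _ hn with ⟨-, hω'⟩ | ⟨hback, -⟩
  · rw [omegaSet_iterate_apply] at hω'
    exact omegaSet_nonempty.not_subset_empty
      ((subset_inter hω hω').trans_eq hC.inter_eq)
  · exact hx (by simpa only [iterate_leftInverse_of_le T.symm_apply_apply le_rfl, Nat.sub_self,
      iterate_zero_apply] using hback n)

lemma diff_biUnion {ι : Type*} {s : Set ι} (hs : s.Finite) {R' C' : ι → Set X}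
    (h : IsRecurrenceRegion T R C) (h' : ∀ i ∈ s, IsRecurrenceRegion T (R' i) (C' i))
    (hC : ∀ i ∈ s, Disjoint C (C' i)) : IsRecurrenceRegion T (R \ ⋃ i ∈ s, R' i) C where
  isClopen := h.isClopen.diff (hs.isClopen_biUnion fun i hi => (h' i hi).isClopen)
  stays := by
    rintro x ⟨hx, hx'⟩
    simp only [mem_iUnion, not_exists] at hx'
    refine (h.stays x hx).imp (fun hf => ⟨fun n => ⟨hf.1 n, ?_⟩, hf.2⟩)
      fun hb => ⟨fun n => ⟨hb.1 n, ?_⟩, hb.2⟩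
    · simp only [mem_iUnion, not_exists]
      exact fun i hi => (h' i hi).iterate_notMem (hC i hi) (hx' i hi) hf.2 n
    · simp only [mem_iUnion, not_exists]
      exact fun i hi => (h' i hi).symm.iterate_notMem (hC i hi) (hx' i hi) hb.2 n

lemma disjointed {k : ℕ} {R C : Fin k → Set X} (h : ∀ i, IsRecurrenceRegion T (R i) (C i))
    (hC : Pairwise (Disjoint on C)) (i : Fin k) :
    IsRecurrenceRegion T (disjointed R i) (C i) := by
  have hR : _root_.disjointed R i = R i \ ⋃ j ∈ Iio i, R j := by
    rw [disjointed_apply, Finset.sup_set_eq_biUnion]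
    simp only [Finset.mem_Iio, mem_Iio]
  rw [hR]
  exact (h i).diff_biUnion (toFinite _) (fun j _ => h j) fun j hj => hC (ne_of_gt hj)

lemma disjoint_of_isRecurrenceClass [T1Space X] (h : IsRecurrenceRegion T R C)
    (hC : IsRecurrenceClass T C') (hCC : Disjoint C' C) : Disjoint C' R := by
  refine Set.disjoint_left.2 fun x hx hxR => ?_
  rcases h.stays x hxR with ⟨-, hω⟩ | ⟨-, hα⟩
  · exact omegaSet_nonempty.not_subset_empty
      ((subset_inter (hC.omegaSet_subset T.continuous hx) hω).trans_eq hCC.inter_eq)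
  · exact omegaSet_nonempty.not_subset_empty
      ((subset_inter (hC.symm.omegaSet_subset T.symm.continuous hx) hα).trans_eq hCC.inter_eq)

end IsRecurrenceRegion

lemma exists_disjoint_isRecurrenceRegion [CompactSpace X] [T1Space X] (T : X ≃ₜ X)
    {R : Set X → Set X} (hCR : ∀ C, IsRecurrenceClass T C → C ⊆ R C)
    (hR : ∀ C, IsRecurrenceClass T C → IsRecurrenceRegion T (R C) C) :
    ∃ (k : ℕ) (C S : Fin k → Set X), (∀ i, IsRecurrenceClass T (C i)) ∧
      (∀ i, IsRecurrenceRegion T (S i) (C i)) ∧ (∀ i, C i ⊆ S i) ∧ (∀ i, S i ⊆ R (C i)) ∧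
      Pairwise (Disjoint on S) ∧
      (∀ x, ∃ n, T^[n] x ∈ ⋃ i, S i) ∧ ∀ x, ∃ n, T.symm^[n] x ∈ ⋃ i, S i := by
  classical
  have hopen : ∀ C, IsRecurrenceClass T C → IsOpen (R C) := fun C hC => (hR C hC).isClopen.isOpen
  obtain ⟨t₁, ht₁, hfwd⟩ := exists_finset_isRecurrenceClass T.continuous hopen hCR
  obtain ⟨t₂, ht₂, hbwd⟩ := exists_finset_isRecurrenceClass T.symm.continuous
    (fun C hC => hopen C hC.symm) fun C hC => hCR C hC.symm
  let e := (t₁ ∪ t₂).equivFin.symm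
  let C : Fin (t₁ ∪ t₂).card → Set X := fun i => e i
  have hC : ∀ i, IsRecurrenceClass T (C i) := fun i =>
    (Finset.mem_union.1 (e i).2).elim (ht₁ _) fun h => (ht₂ _ h).symm
  have hCdisj : Pairwise (Disjoint on C) := fun i j hij => Set.disjoint_left.2 fun x hi hj =>
    hij (e.injective (Subtype.ext ((hC i).eq_of_mem_of_mem T.continuous (hC j) hi hj)))
  have hmem : ∀ c ∈ t₁ ∪ t₂, R c ⊆ ⋃ i, disjointed (fun j => R (C j)) i := fun c hc => by
    rw [iUnion_disjointed]
    simpa [C] using subset_iUnion (fun i => R (C i)) (e.symm ⟨c, hc⟩)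
  refine ⟨_, C, disjointed fun i => R (C i), hC,
    IsRecurrenceRegion.disjointed (fun i => hR _ (hC i)) hCdisj, fun i => ?_,
    disjointed_subset _, disjoint_disjointed _, fun x => ?_, fun x => ?_⟩
  · rw [disjointed_apply, Finset.sup_set_eq_biUnion]
    refine subset_sdiff.2 ⟨hCR _ (hC i), disjoint_iUnion₂_right.2 fun j hj => ?_⟩
    exact (hR _ (hC j)).disjoint_of_isRecurrenceClass (hC i) (hCdisj (Finset.mem_Iio.1 hj).ne')
  · obtain ⟨c, hc, n, hn⟩ := hfwd x
    exact ⟨n, hmem c (Finset.mem_union_left _ hc) hn⟩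
  · obtain ⟨c, hc, n, hn⟩ := hbwd x
    exact ⟨n, hmem c (Finset.mem_union_right _ hc) hn⟩

end RecurrenceRegions

section SplitOrders

/-- An ordered space in which every point is isolated from one side, so that every point has small
clopen intervals as neighbourhoods. -/
class IsSplitOrder (X : Type*) [TopologicalSpace X] [Preorder X] : Prop where
  isOpen_Ici_or_isOpen_Iic : ∀ p : X, IsOpen (Ici p) ∨ IsOpen (Iic p)

instance (X : Type*) [TopologicalSpace X] [Preorder X] [IsSplitOrder X] : IsSplitOrder Xᵒᵈ :=
  ⟨fun p => (IsSplitOrder.isOpen_Ici_or_isOpen_Iic (OrderDual.ofDual p)).symm⟩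

variable {X : Type*} [LinearOrder X] {f g : X → X} {A B N U W : Set X} {p z w : X}

lemma subset_or_subset_of_isLeast (hA : OrdConnected A) (hB : OrdConnected B) (hpA : IsLeast A p)
    (hpB : IsLeast B p) : A ⊆ B ∨ B ⊆ A := by
  refine or_iff_not_imp_left.2 fun hAB => ?_
  obtain ⟨a, ha, haB⟩ := not_subset.1 hAB
  refine fun b hb => hA.out hpA.1 ha ⟨hpB.2 hb, le_of_not_ge fun hab => haB ?_⟩
  exact hB.out hpB.1 hb ⟨hpA.2 ha, hab⟩

lemma ordConnected_inter_preimage (hf : MonotoneOn f A) (hA : OrdConnected A)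
    (hB : OrdConnected B) : OrdConnected (A ∩ f ⁻¹' B) := by
  refine ⟨fun a ha b hb z hz => ?_⟩
  have hzA : z ∈ A := hA.out ha.1 hb.1 hz
  exact ⟨hzA, hB.out ha.2 hb.2 ⟨hf ha.1 hzA hz.1, hf hzA hb.1 hz.2⟩⟩

lemma ordConnected_image_of_subset (hf : StrictMonoOn f B) (hfB : OrdConnected (f '' B))
    (hAB : A ⊆ B) (hA : OrdConnected A) : OrdConnected (f '' A) := by
  refine ⟨?_⟩
  rintro _ ⟨a, ha, rfl⟩ _ ⟨b, hb, rfl⟩ z hz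
  obtain ⟨c, hc, rfl⟩ := hfB.out (mem_image_of_mem f (hAB ha)) (mem_image_of_mem f (hAB hb)) hz
  exact ⟨c, hA.out ha hb ⟨(hf.le_iff_le (hAB ha) hc).1 hz.1, (hf.le_iff_le hc (hAB hb)).1 hz.2⟩,
    rfl⟩

variable [TopologicalSpace X] [OrderTopology X]

lemma isLUB_range_of_mapClusterPt {a : ℕ → X} (ha : Monotone a) (hw : MapClusterPt w atTop a) :
    IsLUB (range a) w := by
  have hupper : w ∈ upperBounds (range a) := by
    rintro _ ⟨k, rfl⟩
    by_contra! hlt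
    obtain ⟨n, hn, hnlt⟩ := frequently_atTop.1
      (mapClusterPt_iff_frequently.1 hw _ (Iio_mem_nhds hlt)) k
    exact (ha hn).not_gt hnlt
  refine isLUB_of_mem_closure hupper ?_
  exact isClosed_closure.mem_of_mapClusterPt hw
    (Eventually.of_forall fun n => subset_closure (mem_range_self n))

lemma isFixedPt_of_mem_omegaSet (hfc : Continuous f) (hf : MonotoneOn f N) (hN : MapsTo f N N)
    (hz : z ∈ N) (hw : w ∈ omegaSet f z) : IsFixedPt f w := by
  have hcl := mem_omegaSet_iff_mapClusterPt.1 hw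
  have hcl' := mem_omegaSet_iff_mapClusterPt.1 (mapsTo_omegaSet hfc hw)
  rcases le_total z (f z) with h | h
  · have hmono := monotone_iterate_of_mapsTo hf hN hz h
    exact (isLUB_range_of_mapClusterPt hmono hcl').unique (isLUB_range_of_mapClusterPt hmono hcl)
  · have hmono := (antitone_iterate_of_mapsTo hf hN hz h).dual_right
    exact (isLUB_range_of_mapClusterPt (X := Xᵒᵈ) hmono hcl').unique
      (isLUB_range_of_mapClusterPt (X := Xᵒᵈ) hmono hcl)

variable [IsSplitOrder X]

lemma exists_isClopen_isLeast (hp : IsOpen (Ici p)) (hW : W ∈ 𝓝 p) :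
    ∃ N, IsClopen N ∧ OrdConnected N ∧ IsLeast N p ∧ N ⊆ W := by
  obtain ⟨b, c, hpI, hIn, hIW⟩ := exists_Icc_mem_subset_of_mem_nhds hW
  have hsub : Icc p c ⊆ W := (Icc_subset_Icc_left hpI.1).trans hIW
  rcases hpI.2.eq_or_lt with rfl | hpc
  · have hopen : IsOpen {p} := (isOpen_singleton_iff_nhds_eq_pure p).2 <|
      (pure_le_nhds p).antisymm' <| le_pure_iff.2 <|
        mem_of_superset (inter_mem hIn (hp.mem_nhds self_mem_Ici))
          fun z hz => le_antisymm hz.1.2 hz.2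
    exact ⟨{p}, ⟨isClosed_singleton, hopen⟩, ordConnected_singleton, isLeast_singleton,
      singleton_subset_iff.2 (mem_of_mem_nhds hW)⟩
  · rcases IsSplitOrder.isOpen_Ici_or_isOpen_Iic c with hc | hc
    · have hclosed : IsClosed (Iio c) := by rw [← compl_Ici]; exact hc.isClosed_compl
      exact ⟨Ico p c, ⟨isClosed_Ici.inter hclosed, hp.inter isOpen_Iio⟩, ordConnected_Ico,
        isLeast_Ico hpc, Ico_subset_Icc_self.trans hsub⟩
    · exact ⟨Icc p c, ⟨isClosed_Icc, hp.inter hc⟩, ordConnected_Icc, isLeast_Icc hpc.le, hsub⟩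

lemma exists_isClopen_mapsTo_of_isOpen_Ici (hgf : LeftInverse g f) (hp : IsFixedPt f p)
    (hIci : IsOpen (Ici p)) (hf : StrictMonoOn f U) (hfU : OrdConnected (f '' U)) (hU : U ∈ 𝓝 p) :
    ∃ N, IsClopen N ∧ p ∈ N ∧ N ⊆ U ∧ (MapsTo f N N ∨ MapsTo g N N) := by
  obtain ⟨N, hN, hNc, hpN, hNU⟩ := exists_isClopen_isLeast hIci hU
  have hleast : IsLeast (f '' N) p := by
    simpa only [hp.eq] using (hf.monotoneOn.mono hNU).map_isLeast hpN
  refine ⟨N, hN, hpN.1, hNU, ?_⟩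
  refine (subset_or_subset_of_isLeast (ordConnected_image_of_subset hf hfU hNU hNc) hNc
    hleast hpN).imp mapsTo_iff_image_subset.2 fun hsub z hz => ?_
  obtain ⟨v, hv, rfl⟩ := hsub hz
  rwa [hgf]

lemma exists_isClopen_mapsTo (hgf : LeftInverse g f) (hp : IsFixedPt f p)
    (hf : StrictMonoOn f U) (hfU : OrdConnected (f '' U)) (hU : U ∈ 𝓝 p) :
    ∃ N, IsClopen N ∧ p ∈ N ∧ N ⊆ U ∧ (MapsTo f N N ∨ MapsTo g N N) := by
  rcases IsSplitOrder.isOpen_Ici_or_isOpen_Iic p with h | h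
  · exact exists_isClopen_mapsTo_of_isOpen_Ici hgf hp h hf hfU hU
  · exact exists_isClopen_mapsTo_of_isOpen_Ici (X := Xᵒᵈ) hgf hp h hf.dual hfU.dual hU

end SplitOrders

section LocallyMonotone

variable {X : Type*} [TopologicalSpace X] [LinearOrder X] {T : X ≃ₜ X} {x y p : X} {K W : Set X}

/-- An open interval on which `T` is increasing, with image an interval. -/
structure IsMonotonePiece (T : X ≃ₜ X) (K : Set X) : Prop where
  isOpen : IsOpen K
  ordConnected : OrdConnected K
  strictMonoOn : StrictMonoOn T K
  ordConnected_image : OrdConnected (T '' K)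

lemma IsMonotonePiece.symm (h : IsMonotonePiece T K) : IsMonotonePiece T.symm (T '' K) where
  isOpen := T.isOpen_image.2 h.isOpen
  ordConnected := h.ordConnected_image
  strictMonoOn := by
    rintro _ ⟨a, ha, rfl⟩ _ ⟨b, hb, rfl⟩ hab
    simpa only [T.symm_apply_apply] using (h.strictMonoOn.lt_iff_lt ha hb).1 hab
  ordConnected_image := by
    rw [← image_comp, T.symm_comp_self, image_id]
    exact h.ordConnected

/-- `T` preserves the order locally: the analogue of a generalized interval exchange, whose finitely
many intervals of continuity correspond to a finite cover by monotone pieces. -/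
def IsLocallyMonotone (T : X ≃ₜ X) : Prop := ∀ x, ∃ K, IsMonotonePiece T K ∧ x ∈ K

namespace IsLocallyMonotone

lemma symm (hT : IsLocallyMonotone T) : IsLocallyMonotone T.symm := fun x =>
  let ⟨K, hK, hx⟩ := hT (T.symm x)
  ⟨T '' K, hK.symm, T.symm x, hx, T.apply_symm_apply x⟩

lemma exists_isMonotonePiece_iterate (hT : IsLocallyMonotone T) (n : ℕ) (p : X) :
    ∃ U, IsOpen U ∧ p ∈ U ∧ OrdConnected U ∧ StrictMonoOn T^[n] U ∧ OrdConnected (T^[n] '' U) := by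
  induction n with
  | zero =>
    exact ⟨univ, isOpen_univ, mem_univ _, ordConnected_univ, strictMonoOn_id, by
      simpa only [iterate_zero, image_id] using ordConnected_univ⟩
  | succ n ih =>
    obtain ⟨U, hUo, hpU, hUc, hUm, hUi⟩ := ih
    obtain ⟨K, hK, hpK⟩ := hT (T^[n] p)
    refine ⟨U ∩ T^[n] ⁻¹' K, hUo.inter (hK.isOpen.preimage (T.continuous.iterate n)),
      ⟨hpU, hpK⟩, ordConnected_inter_preimage hUm.monotoneOn hUc hK.ordConnected, ?_, ?_⟩
    · rw [iterate_succ']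
      exact hK.strictMonoOn.comp (hUm.mono inter_subset_left) fun z hz => hz.2
    · rw [iterate_succ', image_comp, image_inter_preimage]
      exact ordConnected_image_of_subset hK.strictMonoOn hK.ordConnected_image inter_subset_right
        (hUi.inter hK.ordConnected)

end IsLocallyMonotone

end LocallyMonotone

section PeriodicTowers

variable {X : Type*} {f : X → X} {N : Set X} {q n : ℕ} {w z : X}

lemma mapsTo_biUnion_image_iterate (hq : 0 < q) (hmap : MapsTo f^[q] N N) :
    MapsTo f (⋃ i ∈ Iio q, f^[i] '' N) (⋃ i ∈ Iio q, f^[i] '' N) := by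
  intro x hx
  obtain ⟨i, hi, z, hz, rfl⟩ := mem_iUnion₂.1 hx
  rw [← iterate_succ_apply' f]
  rcases (Nat.succ_le_of_lt hi).lt_or_eq with hlt | heq
  · exact mem_biUnion (x := i + 1) hlt ⟨z, hz, rfl⟩
  · exact mem_biUnion (x := 0) hq ⟨_, hmap hz, by rw [← heq, iterate_zero_apply]⟩

lemma dvd_of_iterate_mem (hq : 0 < q) (hmap : MapsTo f^[q] N N)
    (hret : ∀ i ∈ Ioo 0 q, ∀ z ∈ N, f^[i] z ∉ N) (hz : z ∈ N) (hn : f^[n] z ∈ N) : q ∣ n := by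
  by_contra hnd
  refine hret (n % q) ⟨Nat.pos_of_ne_zero fun h => hnd (Nat.dvd_of_mod_eq_zero h),
    Nat.mod_lt n hq⟩ _ (iterate_mul_mem hmap hz (n / q)) ?_
  rwa [← iterate_add_apply, Nat.mod_add_div]

variable [TopologicalSpace X]

lemma minimalPeriod_eq_of_mem_omegaSet [LinearOrder X] [OrderTopology X] (hf : Continuous f)
    (hq : 0 < q) (hN : IsOpen N) (hmap : MapsTo f^[q] N N) (hmono : MonotoneOn f^[q] N)
    (hret : ∀ i ∈ Ioo 0 q, ∀ z ∈ N, f^[i] z ∉ N) (hz : z ∈ N) (hw : w ∈ N)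
    (hwz : w ∈ omegaSet f z) : minimalPeriod f w = q := by
  have hper : IsPeriodicPt f q w := isFixedPt_of_mem_omegaSet (hf.iterate q) hmono hmap hz <|
    mem_omegaSet_iterate_of_forall_dvd (hN.mem_nhds hw) hq
      (fun n hn => dvd_of_iterate_mem hq hmap hret hz hn) hwz
  refine Nat.dvd_antisymm hper.minimalPeriod_dvd (dvd_of_iterate_mem hq hmap hret hw ?_)
  rwa [iterate_minimalPeriod]

lemma isRecurrenceRegion_biUnion_image [LinearOrder X] [OrderTopology X] {T : X ≃ₜ X}
    (hq : 0 < q) (hN : IsClopen N) (hmap : MapsTo T^[q] N N) (hmono : MonotoneOn T^[q] N)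
    (hret : ∀ i ∈ Ioo 0 q, ∀ z ∈ N, T^[i] z ∉ N) :
    IsRecurrenceRegion T (⋃ i ∈ Iio q, T^[i] '' N) {x | minimalPeriod T x = q} := by
  have hclopen : IsClopen (⋃ i ∈ Iio q, T^[i] '' N) := by
    refine (finite_Iio q).isClopen_biUnion fun i _ => ?_
    rw [image_eq_preimage_of_inverse (LeftInverse.iterate T.symm_apply_apply i)
      (LeftInverse.iterate T.apply_symm_apply i)]
    exact hN.preimage (T.symm.continuous.iterate i)
  refine ⟨hclopen, fun x hx => Or.inl ?_⟩
  have hstays : ∀ n, T^[n] x ∈ ⋃ i ∈ Iio q, T^[i] '' N := fun n =>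
    (mapsTo_biUnion_image_iterate hq hmap).iterate n hx
  refine ⟨hstays, fun w hw => ?_⟩
  obtain ⟨i, -, z, hz, rfl⟩ := mem_iUnion₂.1 hx
  obtain ⟨j, -, v, hv, rfl⟩ :=
    mem_iUnion₂.1 (omegaSet_subset_of_forall_mem hclopen.isClosed hstays hw)
  have hvz : v ∈ omegaSet T z := by
    simpa only [omegaSet_iterate_apply, LeftInverse.iterate T.symm_apply_apply j v] using
      (mapsTo_symm_omegaSet T _).iterate j hw
  have hvq : minimalPeriod T v = q :=
    minimalPeriod_eq_of_mem_omegaSet T.continuous hq hN.isOpen hmap hmono hret hz hv hvz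
  rwa [mem_ofPred_eq, minimalPeriod_apply_iterate
    (minimalPeriod_pos_iff_mem_periodicPts.1 (hq.trans_eq hvq.symm))]

lemma exists_mem_nhds_forall_iterate_notMem [T2Space X] (hf : Continuous f) (x : X) :
    ∃ W ∈ 𝓝 x, ∀ i ∈ Ioo 0 (minimalPeriod f x), ∀ z ∈ W, f^[i] z ∉ W := by
  have hsep : ∀ i ∈ Ioo 0 (minimalPeriod f x), ∃ W ∈ 𝓝 x, ∀ z ∈ W, f^[i] z ∉ W := by
    intro i hi
    have hne : x ≠ f^[i] x := fun h =>
      not_isPeriodicPt_of_pos_of_lt_minimalPeriod hi.1.ne' hi.2 h.symm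
    obtain ⟨A, B, hA, hB, hxA, hxB, hAB⟩ := t2_separation hne
    exact ⟨A ∩ f^[i] ⁻¹' B, inter_mem (hA.mem_nhds hxA)
      ((hf.iterate i).continuousAt (hB.mem_nhds hxB)), fun z hz hz' => hAB.le_bot ⟨hz'.1, hz.2⟩⟩
  choose! W hW hWsep using hsep
  refine ⟨_, (biInter_mem (finite_Ioo 0 _)).2 hW, fun i hi z hz hz' => ?_⟩
  exact hWsep i hi z (mem_iInter₂.1 hz i hi) (mem_iInter₂.1 hz' i hi)

end PeriodicTowers

namespace IsLocallyMonotone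

variable {X : Type*} [TopologicalSpace X] [LinearOrder X] [OrderTopology X] [IsSplitOrder X]
  {T : X ≃ₜ X} {y p : X} {W : Set X} {q : ℕ}

lemma exists_isClopen_mapsTo (hT : IsLocallyMonotone T) (hp : IsPeriodicPt T q p) (hW : W ∈ 𝓝 p) :
    ∃ N, IsClopen N ∧ p ∈ N ∧ N ⊆ W ∧
      ((MapsTo T^[q] N N ∧ MonotoneOn T^[q] N) ∨
        (MapsTo T.symm^[q] N N ∧ MonotoneOn T.symm^[q] N)) := by
  obtain ⟨U, hUo, hpU, -, hm, hi⟩ := hT.exists_isMonotonePiece_iterate q p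
  obtain ⟨b, c, -, hI, hIs⟩ := exists_Icc_mem_subset_of_mem_nhds (inter_mem (hUo.mem_nhds hpU) hW)
  have hIU : Icc b c ⊆ U := hIs.trans inter_subset_left
  have hinv := LeftInverse.iterate T.symm_apply_apply q
  obtain ⟨N, hN, hpN, hNI, h⟩ := OrderedDynamics.exists_isClopen_mapsTo hinv
    hp (hm.mono hIU) (ordConnected_image_of_subset hm hi hIU ordConnected_Icc) hI
  have hmN : StrictMonoOn T^[q] N := hm.mono (hNI.trans hIU)
  refine ⟨N, hN, hpN, hNI.trans (hIs.trans inter_subset_right),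
    h.imp (fun h => ⟨h, hmN.monotoneOn⟩) fun h => ⟨h, fun a ha b hb hab => ?_⟩⟩
  rw [← hmN.le_iff_le (h ha) (h hb)]
  simpa only [LeftInverse.iterate T.apply_symm_apply q _] using hab

lemma exists_iterate_eq_of_mem_omegaSet (hT : IsLocallyMonotone T) (hq : 0 < q)
    (hp : IsPeriodicPt T q p) (hω : p ∈ omegaSet T y) (hα : p ∈ omegaSet T.symm y) :
    ∃ n, T^[n] y = p := by
  by_contra! hne
  have hfin : ((fun n => T^[n] y) '' Iic q).Finite := (finite_Iic q).image _
  obtain ⟨N, hN, hpN, hNW, h⟩ := hT.exists_isClopen_mapsTo hp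
    (hfin.isClosed.isOpen_compl.mem_nhds (by rintro ⟨n, -, hn⟩; exact hne n hn))
  have hnhds := hN.isOpen.mem_nhds hpN
  rcases h with ⟨h, -⟩ | ⟨h, -⟩
  · obtain ⟨n, hn⟩ := exists_iterate_mem_of_mem_omegaSet hα hnhds
    have hlt : n < q * (n / q + 1) := Nat.lt_mul_div_succ n hq
    have hret := iterate_mul_mem h hn (n / q + 1)
    rw [iterate_leftInverse_of_ge T.apply_symm_apply hlt.le] at hret
    refine hNW hret ⟨_, mem_Iic.2 ?_, rfl⟩
    rw [mul_add_one, Nat.sub_le_iff_le_add']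
    exact Nat.add_le_add_right (Nat.mul_div_le n q) q
  · obtain ⟨n, hn⟩ := exists_iterate_mem_of_mem_omegaSet hω hnhds
    have hret := iterate_mul_mem h hn (n / q)
    rw [iterate_leftInverse_of_le T.symm_apply_apply (Nat.mul_div_le n q)] at hret
    refine hNW hret ⟨_, mem_Iic.2 ?_, rfl⟩
    rw [← Nat.mod_eq_sub_mul_div]
    exact (Nat.mod_lt n hq).le

lemma exists_isRecurrenceRegion_of_minimalPeriod_eq (hT : IsLocallyMonotone T) (hq : 0 < q)
    (hp : minimalPeriod T p = q) :
    ∃ R, p ∈ R ∧ IsRecurrenceRegion T R {x | minimalPeriod T x = q} := by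
  subst hp
  obtain ⟨W, hW, hret⟩ := exists_mem_nhds_forall_iterate_notMem T.continuous p
  obtain ⟨N, hN, hpN, hNW, h⟩ := hT.exists_isClopen_mapsTo (isPeriodicPt_minimalPeriod T p) hW
  have hretN : ∀ i ∈ Ioo 0 (minimalPeriod T p), ∀ z ∈ N, T^[i] z ∉ N := fun i hi z hz hz' =>
    hret i hi z (hNW hz) (hNW hz')
  rcases h with ⟨hmap, hmono⟩ | ⟨hmap, hmono⟩
  · refine ⟨_, ?_, isRecurrenceRegion_biUnion_image hq hN hmap hmono hretN⟩
    exact mem_iUnion₂.2 ⟨0, hq, p, hpN, rfl⟩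
  · have hreg := isRecurrenceRegion_biUnion_image hq hN hmap hmono fun i hi z hz hz' =>
      hretN i hi _ hz' (by rwa [LeftInverse.iterate T.apply_symm_apply i])
    simp only [minimalPeriod_of_inverse T.symm_apply_apply T.apply_symm_apply] at hreg
    refine ⟨_, ?_, hreg.symm⟩
    exact mem_iUnion₂.2 ⟨0, hq, p, hpN, rfl⟩

lemma isClosed_setOf_minimalPeriod_eq (hT : IsLocallyMonotone T) (hq : 0 < q) :
    IsClosed {x | minimalPeriod T x = q} := by
  refine isClosed_of_closure_subset fun p hp => ?_
  have hper : IsPeriodicPt T q p :=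
    closure_minimal (fun x (hx : minimalPeriod T x = q) => hx ▸ isPeriodicPt_minimalPeriod T x)
      (isClosed_fixedPoints (T.continuous.iterate q)) hp
  obtain ⟨R, hpR, hR⟩ := hT.exists_isRecurrenceRegion_of_minimalPeriod_eq
    (hper.minimalPeriod_pos hq) rfl
  obtain ⟨x, hxR, hx⟩ := mem_closure_iff.1 hp R hR.isClopen.isOpen hpR
  have hxp : minimalPeriod T x = minimalPeriod T p :=
    hR.mem_of_isPeriodicPt hq (hx ▸ isPeriodicPt_minimalPeriod T x) hxR
  exact hxp.symm.trans hx

lemma exists_isRecurrenceRegion_periodic [CompactSpace X] (hT : IsLocallyMonotone T)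
    (hq : 0 < q) : ∃ R, {x | minimalPeriod T x = q} ⊆ R ∧
      IsRecurrenceRegion T R {x | minimalPeriod T x = q} := by
  choose! R hpR hR using fun p (hp : p ∈ {x | minimalPeriod T x = q}) =>
    hT.exists_isRecurrenceRegion_of_minimalPeriod_eq hq hp
  obtain ⟨t, ht, hcover⟩ := (hT.isClosed_setOf_minimalPeriod_eq hq).isCompact.elim_nhds_subcover R
    fun p hp => (hR p hp).isClopen.isOpen.mem_nhds (hpR p hp)
  exact ⟨_, hcover, .biUnion t.finite_toSet fun p hp => hR p (ht p hp)⟩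

end IsLocallyMonotone

section Gaps

variable {X : Type*} [LinearOrder X] {f f' : X → X} {K M : Set X} {g g' : X × X} {x z : X}

/-- `g.1 < g.2` are neighbouring points of `M`. -/
structure IsGap (M : Set X) (g : X × X) : Prop where
  fst_mem : g.1 ∈ M
  snd_mem : g.2 ∈ M
  lt : g.1 < g.2
  notMem : ∀ z ∈ Ioo g.1 g.2, z ∉ M

namespace IsGap

lemma le_fst (hg : IsGap M g) (hz : z ∈ M) (hlt : z < g.2) : z ≤ g.1 :=
  le_of_not_gt fun h => hg.notMem z ⟨h, hlt⟩ hz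

lemma snd_le (hg : IsGap M g) (hz : z ∈ M) (hlt : g.1 < z) : g.2 ≤ z :=
  le_of_not_gt fun h => hg.notMem z ⟨hlt, h⟩ hz

lemma eq_of_mem_Ioo (hg : IsGap M g) (hg' : IsGap M g') (hx : x ∈ Ioo g.1 g.2)
    (hx' : x ∈ Ioo g'.1 g'.2) : g = g' :=
  Prod.ext
    (le_antisymm (hg'.le_fst hg.fst_mem (hx.1.trans hx'.2))
      (hg.le_fst hg'.fst_mem (hx'.1.trans hx.2)))
    (le_antisymm (hg.snd_le hg'.snd_mem (hx.1.trans hx'.2))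
      (hg'.snd_le hg.snd_mem (hx'.1.trans hx.2)))

lemma fst_eq_of_covBy (hg : IsGap M g) (hx : x ∈ Ioo g.1 g.2) (hz : z ∈ M) (hzx : z ⋖ x) :
    g.1 = z :=
  le_antisymm (hzx.le_of_lt hx.1) (hg.le_fst hz (hzx.lt.trans hx.2))

end IsGap

lemma subsingleton_setOf_isGap_of_ordConnected (hK : OrdConnected K) :
    {g | IsGap M g ∧ g.1 ∈ K ∧ g.2 ∉ K}.Subsingleton := by
  have hle : ∀ {g g' : X × X}, IsGap M g → IsGap M g' → g.1 ∈ K → g.2 ∉ K → g'.1 ∈ K →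
      g'.1 ≤ g.1 := fun {g g'} hg hg' h₁ h₂ h₁' => le_of_not_gt fun hlt =>
    h₂ (hK.out h₁ h₁' ⟨hg.lt.le, hg.snd_le hg'.fst_mem hlt⟩)
  rintro g ⟨hg, h₁, h₂⟩ g' ⟨hg', h₁', h₂'⟩
  have hfst : g.1 = g'.1 := le_antisymm (hle hg' hg h₁' h₂' h₁) (hle hg hg' h₁ h₂ h₁')
  exact Prod.ext hfst (le_antisymm (hg.snd_le hg'.snd_mem (hfst ▸ hg'.lt))
    (hg'.snd_le hg.snd_mem (hfst ▸ hg.lt)))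

/-- `f` maps the gap `g` of `M` to a gap, compatibly with the points inside. -/
structure MapsGap (f : X → X) (M : Set X) (g : X × X) : Prop where
  isGap : IsGap M (Prod.map f f g)
  mapsTo : MapsTo f (Ioo g.1 g.2) (Ioo (f g.1) (f g.2))
  covBy : ∀ x ∈ Ioo g.1 g.2, g.1 ⋖ x → f g.1 ⋖ f x

namespace MapsGap

lemma comp (h' : MapsGap f' M (Prod.map f f g)) (h : MapsGap f M g) : MapsGap (f' ∘ f) M g where
  isGap := h'.isGap
  mapsTo := h'.mapsTo.comp h.mapsTo
  covBy := fun x hx hcov => h'.covBy _ (h.mapsTo hx) (h.covBy x hx hcov)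

lemma iterate {F : Set (X × X)} (hF : ∀ g, IsGap M g → g ∉ F → MapsGap f M g) (hg : IsGap M g)
    {n : ℕ} (hn : ∀ k < n, Prod.map f^[k] f^[k] g ∉ F) : MapsGap f^[n] M g := by
  induction n with
  | zero => exact ⟨hg, mapsTo_id _, fun _ _ => id⟩
  | succ n ih =>
    have hmap := ih fun k hk => hn k (hk.trans n.lt_succ_self)
    rw [iterate_succ']
    exact (hF _ hmap.isGap (hn n n.lt_succ_self)).comp hmap

end MapsGap

variable [TopologicalSpace X] {T : X ≃ₜ X}

lemma IsMonotonePiece.mapsGap (hK : IsMonotonePiece T K) (hM : MapsTo T M M)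
    (hM' : MapsTo T.symm M M) (hg : IsGap M g) (h₁ : g.1 ∈ K) (h₂ : g.2 ∈ K) :
    MapsGap T M g := by
  have hIoo : Ioo g.1 g.2 ⊆ K := fun x hx => hK.ordConnected.out h₁ h₂ (Ioo_subset_Icc_self hx)
  have hmaps : MapsTo T (Ioo g.1 g.2) (Ioo (T g.1) (T g.2)) := fun x hx =>
    ⟨hK.strictMonoOn h₁ (hIoo hx) hx.1, hK.strictMonoOn (hIoo hx) h₂ hx.2⟩
  have hsurj : SurjOn T (Ioo g.1 g.2) (Ioo (T g.1) (T g.2)) := by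
    intro z hz
    obtain ⟨x, hx, rfl⟩ := hK.ordConnected_image.out (mem_image_of_mem T h₁)
      (mem_image_of_mem T h₂) (Ioo_subset_Icc_self hz)
    exact ⟨x, ⟨(hK.strictMonoOn.lt_iff_lt h₁ hx).1 hz.1, (hK.strictMonoOn.lt_iff_lt hx h₂).1 hz.2⟩,
      rfl⟩
  refine ⟨⟨hM hg.fst_mem, hM hg.snd_mem, hK.strictMonoOn h₁ h₂ hg.lt, fun z hz hzM => ?_⟩,
    hmaps, fun x hx hcov => ⟨(hmaps hx).1, fun z hz hzx => ?_⟩⟩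
  · obtain ⟨x, hx, rfl⟩ := hsurj hz
    exact hg.notMem x hx (by simpa only [T.symm_apply_apply] using hM' hzM)
  · obtain ⟨y, hy, rfl⟩ := hsurj ⟨hz, hzx.trans (hmaps hx).2⟩
    exact hcov.2 hy.1 ((hK.strictMonoOn.lt_iff_lt (hIoo hy) (hIoo hx)).1 hzx)

lemma IsLocallyMonotone.finite_setOf_not_mapsGap [CompactSpace X] (hT : IsLocallyMonotone T)
    (hM : MapsTo T M M) (hM' : MapsTo T.symm M M) : {g | IsGap M g ∧ ¬ MapsGap T M g}.Finite := by
  choose K hK hxK using hT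
  obtain ⟨t, ht⟩ := isCompact_univ.elim_nhds_subcover K
    fun x _ => (hK x).isOpen.mem_nhds (hxK x)
  refine (t.finite_toSet.biUnion fun x _ =>
    (subsingleton_setOf_isGap_of_ordConnected (M := M) (hK x).ordConnected).finite).subset ?_
  rintro g ⟨hg, hbad⟩
  obtain ⟨x, hx, hgx⟩ := mem_iUnion₂.1 (ht.2 (mem_univ g.1))
  exact mem_biUnion hx ⟨hg, hgx, fun h₂ => hbad ((hK x).mapsGap hM hM' hg hgx h₂)⟩

end Gaps

section GapRegions

variable {X : Type*} [TopologicalSpace X] [LinearOrder X] {T : X ≃ₜ X} {M : Set X}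
  {F : Set (X × X)} {g : X × X} {x u : X}

/-- The gaps of `M` whose orbits meet `F` both in the future and in the past. -/
def trappedGaps (T : X ≃ₜ X) (M : Set X) (F : Set (X × X)) : Set (X × X) :=
  {g | IsGap M g ∧ (∃ n, Prod.map T^[n] T^[n] g ∈ F) ∧ ∃ n, Prod.map T.symm^[n] T.symm^[n] g ∈ F}

lemma trappedGaps_symm : trappedGaps T.symm M F = trappedGaps T M F := by
  ext g
  exact and_congr_right fun _ => and_comm

lemma mem_trappedGaps_of_mem (hg : IsGap M g) (hgF : g ∈ F) : g ∈ trappedGaps T M F :=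
  ⟨hg, ⟨0, hgF⟩, 0, hgF⟩

lemma finite_trappedGaps (hap : ∀ x ∈ M, x ∉ periodicPts T) (hF : F.Finite)
    (hFM : ∀ g ∈ F, IsGap M g) : (trappedGaps T M F).Finite := by
  have hinv : LeftInverse (Prod.map T.symm T.symm) (Prod.map T T) := fun g => by
    simp only [Prod.map_map, T.symm_comp_self, Prod.map_id, id]
  have hinv' : LeftInverse (Prod.map T T) (Prod.map T.symm T.symm) := fun g => by
    simp only [Prod.map_map, T.self_comp_symm, Prod.map_id, id]
  refine (finite_setOf_visits_before_and_after hinv hinv' hF ?_).subset ?_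
  · rintro g hg ⟨n, hn, hper⟩
    exact hap _ (hFM g hg).fst_mem ⟨n, hn, ((isPeriodicPt_prodMap g).1 hper).1⟩
  · simp only [Prod.map_iterate]
    exact fun g hg => hg.2

/-- The convex hull of `M`, without the trapped gaps. For a finite `F` containing the gaps at which
`T` or its inverse is discontinuous, this is a region of recurrence of an aperiodic minimal set. -/
def gapRegion (T : X ≃ₜ X) (M : Set X) (F : Set (X × X)) : Set X :=
  {x | (∃ a ∈ M, a ≤ x) ∧ (∃ b ∈ M, x ≤ b) ∧ ∀ g ∈ trappedGaps T M F, x ∉ Ioo g.1 g.2}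

lemma gapRegion_symm : gapRegion T.symm M F = gapRegion T M F := by
  simp only [gapRegion, trappedGaps_symm]

lemma subset_gapRegion : M ⊆ gapRegion T M F := fun x hx =>
  ⟨⟨x, hx, le_rfl⟩, ⟨x, hx, le_rfl⟩, fun _ hg hxg => hg.1.notMem x hxg hx⟩

lemma iterate_mem_gapRegion (hF : ∀ g, IsGap M g → g ∉ F → MapsGap T M g) (hg : IsGap M g)
    (hx : x ∈ Ioo g.1 g.2) (hfut : ∀ k, Prod.map T^[k] T^[k] g ∉ F) (n : ℕ) :
    T^[n] x ∈ gapRegion T M F := by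
  have hmap : MapsGap T^[n] M g := .iterate hF hg fun k _ => hfut k
  have hxn := hmap.mapsTo hx
  refine ⟨⟨_, hmap.isGap.fst_mem, hxn.1.le⟩, ⟨_, hmap.isGap.snd_mem, hxn.2.le⟩,
    fun g' hg' hx' => ?_⟩
  obtain rfl := hmap.isGap.eq_of_mem_Ioo hg'.1 hxn hx'
  obtain ⟨k, hk⟩ := hg'.2.1
  refine hfut (k + n) ?_
  rwa [iterate_add, ← Prod.map_comp_map, comp_apply]

lemma isOpen_Iic_of_accPt [IsSplitOrder X] {U : Set X} (hu : AccPt u (𝓟 M)) (hU : U ∈ 𝓝 u)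
    (hle : ∀ z ∈ U ∩ M, z ≤ u) : IsOpen (Iic u) := by
  refine (IsSplitOrder.isOpen_Ici_or_isOpen_Iic u).resolve_left fun hIci => ?_
  obtain ⟨y, ⟨⟨huy, hyU⟩, hyM⟩, hne⟩ :=
    accPt_iff_nhds.1 hu _ (inter_mem (hIci.mem_nhds self_mem_Ici) hU)
  exact hne (le_antisymm (hle y ⟨hyU, hyM⟩) huy)

lemma isOpen_Ici_of_accPt [IsSplitOrder X] {U : Set X} (hu : AccPt u (𝓟 M)) (hU : U ∈ 𝓝 u)
    (hle : ∀ z ∈ U ∩ M, u ≤ z) : IsOpen (Ici u) :=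
  isOpen_Iic_of_accPt (X := Xᵒᵈ) hu hU hle

/-- In `R`, the immediate predecessors in `M` of points outside `M` are followed by them. -/
def FollowsLeft (T : X ≃ₜ X) (R M : Set X) : Prop :=
  ∀ x u, (∀ n, T^[n] x ∈ R) → (∀ n, T.symm^[n] x ∈ R) →
    x ∉ M → u ∈ M → u ⋖ x → ∀ n, T^[n] u ⋖ T^[n] x ∧ T.symm^[n] u ⋖ T.symm^[n] x

lemma FollowsLeft.anti {R R' : Set X} (h : FollowsLeft T R M) (hR : R' ⊆ R) :
    FollowsLeft T R' M :=
  fun x u hx hx' => h x u (fun n => hR (hx n)) fun n => hR (hx' n)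

variable [OrderTopology X]

lemma IsGap.isClopen_Ioo [IsSplitOrder X] (hM : Preperfect M) (hg : IsGap M g) :
    IsClopen (Ioo g.1 g.2) := by
  have hIic : IsOpen (Iic g.1) := isOpen_Iic_of_accPt (hM _ hg.fst_mem) (Iio_mem_nhds hg.lt)
    fun z hz => hg.le_fst hz.2 hz.1
  have hIci : IsOpen (Ici g.2) := isOpen_Ici_of_accPt (hM _ hg.snd_mem) (Ioi_mem_nhds hg.lt)
    fun z hz => hg.snd_le hz.2 hz.1
  refine ⟨?_, isOpen_Ioo⟩
  rw [← Ioi_inter_Iio, ← compl_Iic, ← compl_Ici]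
  exact hIic.isClosed_compl.inter hIci.isClosed_compl

variable [CompactSpace X]

lemma isClopen_gapRegion [IsSplitOrder X] (hcl : IsClosed M) (hne : M.Nonempty)
    (hM : Preperfect M) (hfin : (trappedGaps T M F).Finite) : IsClopen (gapRegion T M F) := by
  obtain ⟨a, ha⟩ := hcl.isCompact.exists_isLeast hne
  obtain ⟨b, hb⟩ := hcl.isCompact.exists_isGreatest hne
  have hIci : IsOpen (Ici a) := isOpen_Ici_of_accPt (hM a ha.1) univ_mem fun z hz => ha.2 hz.2
  have hIic : IsOpen (Iic b) := isOpen_Iic_of_accPt (hM b hb.1) univ_mem fun z hz => hb.2 hz.2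
  have heq : gapRegion T M F = (Ici a ∩ Iic b) \ ⋃ g ∈ trappedGaps T M F, Ioo g.1 g.2 := by
    ext x
    simp only [gapRegion, mem_ofPred_eq, Set.mem_sdiff, mem_inter_iff, mem_Ici, mem_Iic, mem_iUnion,
      not_exists, and_assoc]
    exact and_congr ⟨fun ⟨c, hc, hcx⟩ => (ha.2 hc).trans hcx, fun h => ⟨a, ha.1, h⟩⟩
      (and_congr ⟨fun ⟨c, hc, hcx⟩ => hcx.trans (hb.2 hc), fun h => ⟨b, hb.1, h⟩⟩ Iff.rfl)
  rw [heq]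
  exact (IsClopen.inter ⟨isClosed_Ici, hIci⟩ ⟨isClosed_Iic, hIic⟩).diff
    (hfin.isClopen_biUnion fun g hg => hg.1.isClopen_Ioo hM)

lemma exists_isGap_mem_Ioo (hcl : IsClosed M) (hx : x ∉ M) (ha : ∃ a ∈ M, a ≤ x)
    (hb : ∃ b ∈ M, x ≤ b) : ∃ g, IsGap M g ∧ x ∈ Ioo g.1 g.2 := by
  obtain ⟨u, hu⟩ := (hcl.inter isClosed_Iic).isCompact.exists_isGreatest (s := M ∩ Iic x) ha
  obtain ⟨v, hv⟩ := (hcl.inter isClosed_Ici).isCompact.exists_isLeast (s := M ∩ Ici x) hb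
  have hux : u < x := hu.1.2.lt_of_ne fun h => hx (h ▸ hu.1.1)
  have hxv : x < v := hv.1.2.lt_of_ne fun h => hx (h ▸ hv.1.1)
  refine ⟨(u, v), ⟨hu.1.1, hv.1.1, hux.trans hxv, fun z hz hzM => ?_⟩, hux, hxv⟩
  rcases le_total z x with h | h
  · exact (hu.2 ⟨hzM, h⟩).not_gt hz.1
  · exact (hv.2 ⟨hzM, h⟩).not_gt hz.2

lemma omegaSet_subset_of_mem_gap (hcl : IsClosed M) (hap : ∀ x ∈ M, x ∉ periodicPts T)
    (hregion : IsClosed (gapRegion T M F)) (hF : ∀ g, IsGap M g → g ∉ F → MapsGap T M g)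
    (hg : IsGap M g) (hx : x ∈ Ioo g.1 g.2) (hfut : ∀ k, Prod.map T^[k] T^[k] g ∉ F) :
    omegaSet T x ⊆ M := by
  intro w hw
  by_contra hwM
  have hwR := omegaSet_subset_of_forall_mem hregion (iterate_mem_gapRegion hF hg hx hfut) hw
  obtain ⟨g', hg', hwg'⟩ := exists_isGap_mem_Ioo hcl hwM hwR.1 hwR.2.1
  have hnhds := isOpen_Ioo.mem_nhds hwg'
  -- the images of the gap around `x` are distinct gaps, so the orbit cannot return to one of them
  obtain ⟨m, -, hm⟩ := mem_omegaSet_iff.1 hw _ hnhds 0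
  obtain ⟨n, hmn, hn⟩ := mem_omegaSet_iff.1 hw _ hnhds (m + 1)
  have hgap : ∀ k, T^[k] x ∈ Ioo g'.1 g'.2 → T^[k] g.1 = g'.1 := fun k hk =>
    have hmap : MapsGap T^[k] M g := .iterate hF hg fun j _ => hfut j
    congrArg Prod.fst (hmap.isGap.eq_of_mem_Ioo hg' (hmap.mapsTo hx) hk)
  have heq : m = n := iterate_injective_of_notMem_periodicPts T.injective (hap _ hg.fst_mem)
    ((hgap m hm).trans (hgap n hn).symm)
  omega

lemma covBy_iterate_of_forall_mem_gapRegion (hcl : IsClosed M)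
    (hF : ∀ g, IsGap M g → g ∉ F → MapsGap T M g) (hx : ∀ n, T^[n] x ∈ gapRegion T M F)
    (hxM : x ∉ M) (hu : u ∈ M) (hux : u ⋖ x) (n : ℕ) : T^[n] u ⋖ T^[n] x := by
  obtain ⟨g, hg, hxg⟩ := exists_isGap_mem_Ioo hcl hxM (hx 0).1 (hx 0).2.1
  obtain rfl := hg.fst_eq_of_covBy hxg hu hux
  by_cases hfut : ∀ k, Prod.map T^[k] T^[k] g ∉ F
  · exact (MapsGap.iterate hF hg fun k _ => hfut k).covBy x hxg hux
  · classical
    push Not at hfut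
    have hmap : MapsGap T^[Nat.find hfut] M g :=
      .iterate hF hg fun k hk => Nat.find_min hfut hk
    exact ((hx _).2.2 _ (mem_trappedGaps_of_mem hmap.isGap (Nat.find_spec hfut))
      (hmap.mapsTo hxg)).elim

variable [IsSplitOrder X]

lemma IsAperiodicMinimal.isRecurrenceRegion_gapRegion (hM : IsAperiodicMinimal T M)
    (hFfin : F.Finite) (hFM : ∀ g ∈ F, IsGap M g) (hF : ∀ g, IsGap M g → g ∉ F → MapsGap T M g)
    (hF' : ∀ g, IsGap M g → g ∉ F → MapsGap T.symm M g) :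
    IsRecurrenceRegion T (gapRegion T M F) M := by
  have hcl := hM.isMinimalSet.isClosed
  have hclopen : IsClopen (gapRegion T M F) :=
    isClopen_gapRegion hcl hM.isMinimalSet.nonempty (hM.preperfect T.continuous)
      (finite_trappedGaps hM.notMem_periodicPts hFfin hFM)
  refine ⟨hclopen, fun x hx => ?_⟩
  by_cases hxM : x ∈ M
  · exact Or.inl ⟨fun n => subset_gapRegion (hM.isMinimalSet.mapsTo.iterate n hxM),
      (hM.isMinimalSet.omegaSet_eq T.continuous hxM).le⟩
  obtain ⟨g, hg, hxg⟩ := exists_isGap_mem_Ioo hcl hxM hx.1 hx.2.1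
  by_cases hfut : ∀ k, Prod.map T^[k] T^[k] g ∉ F
  · exact Or.inl ⟨iterate_mem_gapRegion hF hg hxg hfut,
      omegaSet_subset_of_mem_gap hcl hM.notMem_periodicPts hclopen.isClosed hF hg hxg hfut⟩
  · have hpast : ∀ k, Prod.map T.symm^[k] T.symm^[k] g ∉ F := by
      push Not at hfut
      exact fun k hk => hx.2.2 g ⟨hg, hfut, k, hk⟩ hxg
    rw [← gapRegion_symm] at hclopen ⊢
    exact Or.inr ⟨iterate_mem_gapRegion hF' hg hxg hpast,
      omegaSet_subset_of_mem_gap hcl hM.symm.notMem_periodicPts hclopen.isClosed hF' hg hxg hpast⟩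

lemma IsAperiodicMinimal.exists_isRecurrenceRegion (hM : IsAperiodicMinimal T M)
    (hT : IsLocallyMonotone T) :
    ∃ R, M ⊆ R ∧ IsRecurrenceRegion T R M ∧ FollowsLeft T R M := by
  let F : Set (X × X) := {g | IsGap M g ∧ ¬ (MapsGap T M g ∧ MapsGap T.symm M g)}
  have hmaps := hM.isMinimalSet.mapsTo
  have hmaps' := hM.isMinimalSet.mapsTo_symm
  have hFfin : F.Finite := ((hT.finite_setOf_not_mapsGap hmaps hmaps').union
      (hT.symm.finite_setOf_not_mapsGap hmaps' hmaps)).subset fun g hg =>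
    (not_and_or.1 hg.2).imp (⟨hg.1, ·⟩) (⟨hg.1, ·⟩)
  have hF : ∀ g, IsGap M g → g ∉ F → MapsGap T M g ∧ MapsGap T.symm M g := fun g hg hgF =>
    not_not.1 fun h => hgF ⟨hg, h⟩
  refine ⟨gapRegion T M F, subset_gapRegion,
    hM.isRecurrenceRegion_gapRegion hFfin (fun g hg => hg.1) (fun g hg hgF => (hF g hg hgF).1)
      fun g hg hgF => (hF g hg hgF).2, fun x u hx hx' hxM hu hux n => ⟨?_, ?_⟩⟩
  · exact covBy_iterate_of_forall_mem_gapRegion hM.isMinimalSet.isClosed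
      (fun g hg hgF => (hF g hg hgF).1) hx hxM hu hux n
  · rw [← gapRegion_symm] at hx'
    exact covBy_iterate_of_forall_mem_gapRegion hM.isMinimalSet.isClosed
      (fun g hg hgF => (hF g hg hgF).2) hx' hxM hu hux n

end GapRegions

section Decomposition

variable {X : Type*} [TopologicalSpace X] [CompactSpace X] [LinearOrder X] [OrderTopology X]
  [IsSplitOrder X] {T : X ≃ₜ X} {C : Set X}

lemma IsRecurrenceClass.exists_isRecurrenceRegion (hC : IsRecurrenceClass T C)
    (hT : IsLocallyMonotone T) :
    ∃ R, C ⊆ R ∧ IsRecurrenceRegion T R C ∧ (IsAperiodicMinimal T C → FollowsLeft T R C) := by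
  by_cases hap : IsAperiodicMinimal T C
  · obtain ⟨R, hCR, hR, hleft⟩ := hap.exists_isRecurrenceRegion hT
    exact ⟨R, hCR, hR, fun _ => hleft⟩
  · cases hC with
    | periodic hq _ =>
      obtain ⟨R, hCR, hR⟩ := hT.exists_isRecurrenceRegion_periodic hq
      exact ⟨R, hCR, hR, fun h => (hap h).elim⟩
    | aperiodic h => exact (hap h).elim

theorem IsLocallyMonotone.exists_decomposition (hT : IsLocallyMonotone T) :
    ∃ (k : ℕ) (C R : Fin k → Set X), (∀ i, IsRecurrenceClass T (C i)) ∧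
      (∀ i, IsAperiodicMinimal T (C i) → FollowsLeft T (R i) (C i)) ∧
      (∀ i, IsRecurrenceRegion T (R i) (C i)) ∧ (∀ i, C i ⊆ R i) ∧ Pairwise (Disjoint on R) ∧
      (∀ x, ∃ n, T^[n] x ∈ ⋃ i, R i) ∧ ∀ x, ∃ n, T.symm^[n] x ∈ ⋃ i, R i := by
  choose! R hCR hR hleft using fun C (hC : IsRecurrenceClass T C) =>
    hC.exists_isRecurrenceRegion hT
  obtain ⟨k, C, S, hC, hS, hCS, hSR, hdisj, hfwd, hbwd⟩ := exists_disjoint_isRecurrenceRegion T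
    hCR hR
  exact ⟨k, C, S, hC, fun i h => (hleft _ (hC i) h).anti (hSR i), hS, hCS, hdisj, hfwd, hbwd⟩

end Decomposition

section HalfOpenIntervals

variable {α : Type*} [LinearOrder α] {a b c d x : α} {s : Bool}

/-- The half-open interval with end points `a` and `b` that contains its left end point if `s` is
`true` and its right end point if `s` is `false`. -/
def halfOpen : Bool → α → α → Set α
  | true, a, b => Ico a b
  | false, a, b => Ioc a b

lemma halfOpen_subset_Icc : halfOpen s a b ⊆ Icc a b :=
  match s with
  | true => Ico_subset_Icc_self
  | false => Ioc_subset_Icc_self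

lemma halfOpen_subset_halfOpen (hab : a < b) (h : Ico a b ⊆ Ico c d) :
    halfOpen s a b ⊆ halfOpen s c d := by
  have hcd := (Ico_subset_Ico_iff hab).1 h
  cases s with
  | true => exact h
  | false => exact Ioc_subset_Ioc hcd.1 hcd.2

lemma disjoint_halfOpen (h : Disjoint (Ico a b) (Ico c d)) :
    Disjoint (halfOpen s a b) (halfOpen s c d) := by
  cases s with
  | true => exact h
  | false => exact Ioc_disjoint_Ioc.2 (Ico_disjoint_Ico.1 h)

lemma apply_mem_halfOpen_iff {β : Type*} [LinearOrder β] {g : α → β}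
    (hg : StrictMonoOn g (Icc a b)) (hx : x ∈ Icc a b) :
    g x ∈ halfOpen s (g a) (g b) ↔ x ∈ halfOpen s a b := by
  have ha : a ∈ Icc a b := left_mem_Icc.2 (hx.1.trans hx.2)
  have hb : b ∈ Icc a b := right_mem_Icc.2 (hx.1.trans hx.2)
  cases s with
  | true => exact and_congr (hg.le_iff_le ha hx) (hg.lt_iff_lt hx hb)
  | false => exact and_congr (hg.lt_iff_lt ha hx) (hg.le_iff_le hx hb)

lemma exists_mem_halfOpen {ι : Type*} [Finite ι] {l r : ι → α}
    (h : Ico a b ⊆ ⋃ i, Ico (l i) (r i)) (hx : x ∈ halfOpen s a b) :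
    ∃ i, x ∈ halfOpen s (l i) (r i) := by
  cases s with
  | true => exact mem_iUnion.1 (h hx)
  | false =>
    obtain ⟨i₀, hi₀⟩ := mem_iUnion.1 (h ⟨le_rfl, hx.1.trans_le hx.2⟩)
    obtain ⟨i, hi, hmax⟩ :=
      (toFinite {i | l i < x}).exists_maximalFor r _ ⟨i₀, hi₀.1.trans_lt hx.1⟩
    refine ⟨i, hi, not_lt.1 fun hlt => ?_⟩
    have ha : a ≤ r i := (le_total (r i₀) (r i)).elim hi₀.2.le.trans fun hle =>
      hi₀.2.le.trans (hmax (hi₀.1.trans_lt hx.1) hle)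
    obtain ⟨j, hj⟩ := mem_iUnion.1 (h ⟨ha, hlt.trans_le hx.2⟩)
    exact hj.2.not_ge (hmax (hj.1.trans_lt hlt) hj.2.le)

/-- The action of `f` on the two copies of a point `x`: the value `f x` if `s` is `true`, the left
limit of `f` at `x` otherwise. -/
noncomputable def sideLim {β : Type*} [TopologicalSpace β] (f : α → β) : Bool → α → β
  | true => f
  | false => leftLim f

lemma sideLim_eq {β : Type*} [TopologicalSpace β] [T2Space β] [TopologicalSpace α]
    [OrderTopology α] [DenselyOrdered α] {f g : α → β} (hg : ContinuousOn g (Icc a b))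
    (hfg : EqOn f g (Ico a b)) (hx : x ∈ halfOpen s a b) : sideLim f s x = g x := by
  cases s with
  | true => exact hfg hx
  | false =>
    have hev : ∀ᶠ z in 𝓝[<] x, z ∈ Ico a b := by
      filter_upwards [Ioo_mem_nhdsLT hx.1] with z hz
      exact ⟨hz.1.le, hz.2.trans_le hx.2⟩
    have hlim : Tendsto g (𝓝[<] x) (𝓝 (g x)) :=
      (hg x ⟨hx.1.le, hx.2⟩).mono_left <| le_inf nhdsWithin_le_nhds <|
        le_principal_iff.2 (hev.mono fun z hz => Ico_subset_Icc_self hz)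
    have := nhdsLT_neBot_of_exists_lt ⟨a, hx.1⟩
    exact leftLim_eq_of_tendsto (hlim.congr' (hev.mono fun z hz => (hfg hz).symm))

end HalfOpenIntervals

lemma continuousOn_of_strictMonoOn {X Y : Type*} [LinearOrder X] [TopologicalSpace X]
    [OrderTopology X] [LinearOrder Y] [TopologicalSpace Y] [OrderTopology Y] {f : X → Y}
    {K : Set X} [OrdConnected K] [OrdConnected (f '' K)] (hf : StrictMonoOn f K) :
    ContinuousOn f K :=
  continuousOn_iff_continuous_domRestrict.2
    (continuous_subtype_val.comp (hf.orderIso f K).continuous)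

/-- The double arrow space of `[0, 1]`: each point of `(0, 1)` is split into a left copy followed by
a right copy, `0` has only a right copy and `1` only a left one. The field `right` tells which copy
of `val` is meant. -/
@[ext]
structure DArrow where
  val : ℝ
  right : Bool
  mem : val ∈ halfOpen right 0 1

namespace DArrow

variable {p u : DArrow} {s : Bool} {a b x : ℝ} {K : Set DArrow}

noncomputable instance : LinearOrder DArrow :=
  LinearOrder.lift' (fun p => toLex (p.val, p.right)) fun _ _ h =>
    DArrow.ext (congrArg Prod.fst (toLex.injective h)) (congrArg Prod.snd (toLex.injective h))

noncomputable instance : TopologicalSpace DArrow := Preorder.topology DArrow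

instance : OrderTopology DArrow := ⟨rfl⟩

/-- The set of all right copies of points if `s` is `true`, of all left copies otherwise. -/
def sheet (s : Bool) : Set DArrow := {p | p.right = s}

lemma mem_sheet_false_or_true (p : DArrow) : p ∈ sheet false ∨ p ∈ sheet true :=
  Bool.eq_false_or_eq_true p.right |>.symm

lemma lt_iff : p < u ↔ p.val < u.val ∨ p.val = u.val ∧ p ∈ sheet false ∧ u ∈ sheet true :=
  Prod.Lex.toLex_lt_toLex.trans (or_congr_right (and_congr_right' Bool.lt_iff))

lemma monotone_val : Monotone val := fun _ _ h =>
  h.eq_or_lt.elim (fun h => h ▸ le_rfl) fun h => (lt_iff.1 h).elim le_of_lt fun h => h.1.le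

lemma lt_iff_of_mem_sheet_true (hp : p ∈ sheet true) : p < u ↔ p.val < u.val :=
  lt_iff.trans (or_iff_left fun h => Bool.false_ne_true (h.2.1.symm.trans hp))

lemma lt_iff_of_mem_sheet_false (hp : p ∈ sheet false) : u < p ↔ u.val < p.val :=
  lt_iff.trans (or_iff_left fun h => Bool.false_ne_true (hp.symm.trans h.2.2))

lemma val_mem_halfOpen (hp : p ∈ sheet s) : p.val ∈ halfOpen s 0 1 := hp ▸ p.mem

lemma val_mem_Icc (p : DArrow) : p.val ∈ Icc 0 1 := halfOpen_subset_Icc p.mem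

lemma injOn_val_sheet (s : Bool) : InjOn val (sheet s) := fun _ hp _ hu h =>
  DArrow.ext h (Eq.trans hp (Eq.symm hu))

lemma ne_of_mem_sheet (hu : u ∈ sheet false) (hp : p ∈ sheet true) : u ≠ p := fun h =>
  Bool.false_ne_true (hu.symm.trans (h ▸ hp))

/-- The right copy of `x`. -/
def plus (x : ℝ) (hx : x ∈ Ico 0 1) : DArrow := ⟨x, true, hx⟩

/-- The left copy of `x`. -/
def minus (x : ℝ) (hx : x ∈ Ioc 0 1) : DArrow := ⟨x, false, hx⟩

lemma plus_val (hp : p ∈ sheet true) : plus p.val (val_mem_halfOpen hp) = p :=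
  injOn_val_sheet true rfl hp rfl

lemma minus_val (hp : p ∈ sheet false) : minus p.val (val_mem_halfOpen hp) = p :=
  injOn_val_sheet false rfl hp rfl

lemma covBy_of_val_eq (hu : u ∈ sheet false) (hp : p ∈ sheet true) (h : u.val = p.val) :
    u ⋖ p := by
  refine ⟨lt_iff.2 (.inr ⟨h, hu, hp⟩), fun c huc hcp => ?_⟩
  have hval := le_antisymm (monotone_val huc.le) (h ▸ monotone_val hcp.le)
  rcases c.mem_sheet_false_or_true with hc | hc
  · exact huc.ne (injOn_val_sheet false hu hc hval)
  · exact hcp.ne (injOn_val_sheet true hc hp (hval.symm.trans h))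

lemma val_eq_of_covBy (h : p ⋖ u) : p.val = u.val := by
  refine (monotone_val h.le).eq_of_not_lt fun hlt => ?_
  obtain ⟨x, hpx, hxu⟩ := exists_between hlt
  exact h.2 (c := plus x ⟨p.val_mem_Icc.1.trans hpx.le, hxu.trans_le u.val_mem_Icc.2⟩)
    (lt_iff.2 (.inl hpx)) (lt_iff.2 (.inl hxu))

section SplitOrder

lemma isOpen_Ici (hp : p ∈ sheet true) : IsOpen (Ici p) := by
  rcases p.val_mem_Icc.1.eq_or_lt with h | h
  · suffices huniv : Ici p = univ from huniv ▸ isOpen_univ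
    refine eq_univ_of_forall fun u => mem_Ici.2 (not_lt.1 fun hlt => ?_)
    rcases lt_iff.1 hlt with hlt | ⟨heq, hu, -⟩
    · exact u.val_mem_Icc.1.not_gt (hlt.trans_eq h.symm)
    · exact (val_mem_halfOpen hu).1.ne' (heq.trans h.symm)
  · rw [← (covBy_of_val_eq (u := minus p.val ⟨h, p.val_mem_Icc.2⟩) rfl hp rfl).Ioi_eq]
    exact isOpen_Ioi

lemma isOpen_Iic (hp : p ∈ sheet false) : IsOpen (Iic p) := by
  rcases p.val_mem_Icc.2.eq_or_lt with h | h
  · suffices huniv : Iic p = univ from huniv ▸ isOpen_univ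
    refine eq_univ_of_forall fun u => mem_Iic.2 (not_lt.1 fun hlt => ?_)
    rcases lt_iff.1 hlt with hlt | ⟨heq, -, hu⟩
    · exact u.val_mem_Icc.2.not_gt (h.symm.trans_lt hlt)
    · exact (val_mem_halfOpen hu).2.ne (heq.symm.trans h)
  · rw [← (covBy_of_val_eq (p := plus p.val ⟨p.val_mem_Icc.1, h⟩) hp rfl rfl).Iio_eq]
    exact isOpen_Iio

instance : IsSplitOrder DArrow where
  isOpen_Ici_or_isOpen_Iic p := by
    cases h : p.right with
    | true => exact .inl (isOpen_Ici h)
    | false => exact .inr (isOpen_Iic h)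

/-- The points of the double arrow space over the interval with end points `a` and `b`: the right
copies of the points of `[a, b)` and the left copies of the points of `(a, b]`. -/
def box (a b : ℝ) : Set DArrow := {p | p.val ∈ halfOpen p.right a b}

lemma mem_box_iff (hp : p ∈ sheet s) : p ∈ box a b ↔ p.val ∈ halfOpen s a b := by
  rw [← mem_ofPred.1 hp]
  rfl

lemma box_eq_Icc (ha : a ∈ Ico 0 1) (hb : b ∈ Ioc 0 1) :
    box a b = Icc (plus a ha) (minus b hb) := by
  ext q
  rcases q.mem_sheet_false_or_true with hq | hq <;> rw [mem_box_iff hq]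
  · have hle : plus a ha ≤ q ↔ a < q.val :=
      (ne_of_mem_sheet hq rfl).symm.le_iff_lt.trans (lt_iff_of_mem_sheet_false hq)
    exact and_congr hle.symm
      (le_iff_le_iff_lt_iff_lt.2 (lt_iff_of_mem_sheet_false (u := minus b hb) hq).symm)
  · have hle : q ≤ minus b hb ↔ q.val < b :=
      (ne_of_mem_sheet rfl hq).symm.le_iff_lt.trans (lt_iff_of_mem_sheet_true hq)
    exact and_congr
      (le_iff_le_iff_lt_iff_lt.2 (lt_iff_of_mem_sheet_true (u := plus a ha) hq).symm) hle.symm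

lemma isClopen_box (hab : a < b) (h : Ico a b ⊆ Ico 0 1) : IsClopen (box a b) := by
  have hcd := (Ico_subset_Ico_iff hab).1 h
  rw [box_eq_Icc ⟨hcd.1, hab.trans_le hcd.2⟩ ⟨hcd.1.trans_lt hab, hcd.2⟩]
  exact ⟨isClosed_Icc, (isOpen_Ici rfl).inter (isOpen_Iic rfl)⟩

lemma ordConnected_box (hab : a < b) (h : Ico a b ⊆ Ico 0 1) : OrdConnected (box a b) := by
  have hcd := (Ico_subset_Ico_iff hab).1 h
  rw [box_eq_Icc ⟨hcd.1, hab.trans_le hcd.2⟩ ⟨hcd.1.trans_lt hab, hcd.2⟩]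
  exact ordConnected_Icc

lemma exists_box_subset (hK : K ∈ 𝓝 p) :
    ∃ a b, a < b ∧ Ico a b ⊆ Ico 0 1 ∧ p ∈ box a b ∧ box a b ⊆ K := by
  rcases p.mem_sheet_false_or_true with hp | hp
  · have hp01 := val_mem_halfOpen hp
    obtain ⟨l, hlp, hK⟩ := exists_Ioc_subset_of_mem_nhds hK
      ⟨plus 0 (left_mem_Ico.2 one_pos), lt_iff.2 (.inl hp01.1)⟩
    obtain ⟨a, hla, hap⟩ := exists_between ((lt_iff_of_mem_sheet_false hp).1 hlp)
    have ha : 0 ≤ a := l.val_mem_Icc.1.trans hla.le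
    refine ⟨a, p.val, hap, Ico_subset_Ico ha hp01.2, ?_, ?_⟩
    all_goals rw [box_eq_Icc ⟨ha, hap.trans_le hp01.2⟩ hp01, minus_val hp]
    · exact ⟨lt_iff.2 (.inl hap) |>.le, le_rfl⟩
    · exact fun q hq => hK ⟨(lt_iff.2 (.inl hla)).trans_le hq.1, hq.2⟩
  · have hp01 := val_mem_halfOpen hp
    obtain ⟨u, hpu, hK⟩ := exists_Ico_subset_of_mem_nhds hK
      ⟨minus 1 (right_mem_Ioc.2 one_pos), lt_iff.2 (.inl hp01.2)⟩
    obtain ⟨b, hpb, hbu⟩ := exists_between ((lt_iff_of_mem_sheet_true hp).1 hpu)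
    have hb : b ≤ 1 := hbu.le.trans u.val_mem_Icc.2
    refine ⟨p.val, b, hpb, Ico_subset_Ico hp01.1 hb, ?_, ?_⟩
    all_goals rw [box_eq_Icc hp01 ⟨hp01.1.trans_lt hpb, hb⟩, plus_val hp]
    · exact ⟨le_rfl, lt_iff.2 (.inl hpb) |>.le⟩
    · exact fun q hq => hK ⟨hq.1, hq.2.trans_lt (lt_iff.2 (.inl hbu))⟩

end SplitOrder

section Compactness

lemma continuous_val : Continuous val := by
  have hsurj : Surjective fun p : DArrow => (⟨p.val, p.val_mem_Icc⟩ : Icc (0 : ℝ) 1) := by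
    rintro ⟨x, h0, h1⟩
    rcases h1.lt_or_eq with h | rfl
    · exact ⟨plus x ⟨h0, h⟩, rfl⟩
    · exact ⟨minus 1 (right_mem_Ioc.2 one_pos), rfl⟩
  exact continuous_subtype_val.comp
    (Monotone.continuous_of_surjective (fun _ _ h => monotone_val h) hsurj)

lemma le_nhds_of_mem_sheet_true {F : Filter DArrow} (hp : p ∈ sheet true)
    (hF : Tendsto val F (𝓝 p.val)) (hle : ∀ᶠ q in F, p ≤ q) : F ≤ 𝓝 p := by
  refine tendsto_id'.1 (tendsto_order.2 ⟨fun u hu => hle.mono fun q => hu.trans_le, fun u hu => ?_⟩)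
  exact (hF.eventually_lt_const ((lt_iff_of_mem_sheet_true hp).1 hu)).mono fun q hq =>
    lt_iff.2 (.inl hq)

lemma le_nhds_of_mem_sheet_false {F : Filter DArrow} (hp : p ∈ sheet false)
    (hF : Tendsto val F (𝓝 p.val)) (hle : ∀ᶠ q in F, q ≤ p) : F ≤ 𝓝 p := by
  refine tendsto_id'.1 (tendsto_order.2
    ⟨fun u hu => ?_, fun u hu => hle.mono fun q hq => hq.trans_lt hu⟩)
  exact (hF.eventually_const_lt ((lt_iff_of_mem_sheet_false hp).1 hu)).mono fun q hq =>
    lt_iff.2 (.inl hq)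

instance : CompactSpace DArrow where
  isCompact_univ := by
    refine isCompact_iff_ultrafilter_le_nhds.2 fun F _ => ?_
    obtain ⟨x, hx, hFx⟩ := isCompact_Icc.ultrafilter_le_nhds (F.map val)
      (tendsto_principal.2 (.of_forall val_mem_Icc))
    rcases F.em fun q => q.val < x ∨ q.val = x ∧ q ∈ sheet false with hle | hge
    · obtain ⟨q, hq⟩ := hle.exists
      have hx0 : 0 < x :=
        hq.elim q.val_mem_Icc.1.trans_lt fun h => h.1 ▸ (val_mem_halfOpen h.2).1
      exact ⟨minus x ⟨hx0, hx.2⟩, mem_univ _, le_nhds_of_mem_sheet_false rfl hFx <|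
        hle.mono fun q hq => hq.elim (fun h => (lt_iff.2 (.inl h)).le)
          fun h => (injOn_val_sheet false h.2 rfl h.1).le⟩
    · have hge' : ∀ᶠ q in (F : Filter DArrow), x < q.val ∨ x = q.val ∧ q ∈ sheet true :=
        hge.mono fun q hq => by have := q.mem_sheet_false_or_true; grind
      obtain ⟨q, hq⟩ := hge'.exists
      have hx1 : x < 1 :=
        hq.elim (fun h => h.trans_le q.val_mem_Icc.2) fun h => h.1 ▸ (val_mem_halfOpen h.2).2
      exact ⟨plus x ⟨hx.1, hx1⟩, mem_univ _, le_nhds_of_mem_sheet_true rfl hFx <|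
        hge'.mono fun q hq => hq.elim (fun h => (lt_iff.2 (.inl h)).le)
          fun h => (injOn_val_sheet true rfl h.2 h.1).le⟩

end Compactness

section Real

/-- The set of the points of `[0, 1)` whose right copy lies in `K`. -/
def real (K : Set DArrow) : Set ℝ := val '' (sheet true ∩ K)

lemma Ico_subset_real (h : Ico a b ⊆ Ico 0 1) (hK : box a b ⊆ K) : Ico a b ⊆ real K :=
  fun x hx => ⟨plus x (h hx), ⟨rfl, hK hx⟩, rfl⟩

lemma real_univ : real univ = Ico 0 1 := by
  rw [real, inter_univ]
  ext x
  refine ⟨?_, fun hx => ⟨plus x hx, rfl, rfl⟩⟩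
  rintro ⟨p, hp, rfl⟩
  exact val_mem_halfOpen hp

lemma disjoint_real {K' : Set DArrow} (h : Disjoint K K') : Disjoint (real K) (real K') :=
  disjoint_image_image fun _ hp _ hu heq =>
    h.ne_of_mem hp.2 hu.2 (injOn_val_sheet true hp.1 hu.1 heq)

lemma real_union_iUnion {ι : Sort*} (K : Set DArrow) (R : ι → Set DArrow) :
    real K ∪ ⋃ i, real (R i) = real (K ∪ ⋃ i, R i) := by
  simp only [real, inter_union_distrib_left, inter_iUnion, image_union, image_iUnion]

lemma isRightOpenUnion_real (hK : IsClopen K) : IsRightOpenUnion (real K) := by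
  have hbox : ∀ p ∈ K, ∃ q : ℝ × ℝ, box q.1 q.2 ∈ 𝓝 p ∧ Ico q.1 q.2 ⊆ real K := fun p hp => by
    obtain ⟨a, b, hab, h, hp, hsub⟩ := exists_box_subset (hK.isOpen.mem_nhds hp)
    exact ⟨(a, b), (isClopen_box hab h).isOpen.mem_nhds hp, Ico_subset_real h hsub⟩
  choose! q hq hreal using hbox
  obtain ⟨t, ht, hcover⟩ :=
    hK.isClosed.isCompact.elim_nhds_subcover (fun p => box (q p).1 (q p).2) hq
  classical
  refine ⟨t.image q, ?_⟩
  rw [Finset.set_biUnion_finset_image]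
  refine Subset.antisymm ?_ (iUnion₂_subset fun p hp => hreal p (ht p hp))
  rintro _ ⟨p, ⟨hs, hp⟩, rfl⟩
  obtain ⟨u, hu, hpu⟩ := mem_iUnion₂.1 (hcover hp)
  exact mem_iUnion₂.2 ⟨u, hu, mem_box_iff hs |>.1 hpu⟩

lemma eventually_mem_real (hK : IsOpen K) (hp : p ∈ sheet false ∩ K) :
    ∀ᶠ z in 𝓝[<] p.val, z ∈ real K := by
  obtain ⟨a, b, -, hsub, hpab, hbK⟩ := exists_box_subset (hK.mem_nhds hp.2)
  rw [mem_box_iff hp.1] at hpab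
  filter_upwards [Ioo_mem_nhdsLT hpab.1] with z hz
  exact Ico_subset_real hsub hbK ⟨hz.1.le, hz.2.trans_le hpab.2⟩

lemma setOf_eventually_mem_real (hK : IsClopen K) :
    {y | ∀ᶠ z in 𝓝[<] y, z ∈ real K} = val '' (sheet false ∩ K) := by
  refine Subset.antisymm (fun y (hy : ∀ᶠ z in 𝓝[<] y, z ∈ real K) => ?_) ?_
  · have hy01 : y ∈ Ioc (0 : ℝ) 1 := by
      refine ⟨?_, not_lt.1 fun hlt => ?_⟩
      · obtain ⟨_, ⟨p, -, rfl⟩, hlt⟩ := (hy.and self_mem_nhdsWithin).exists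
        exact p.val_mem_Icc.1.trans_lt hlt
      · obtain ⟨_, ⟨p, -, rfl⟩, hz⟩ := (hy.and (Ioo_mem_nhdsLT hlt)).exists
        exact hz.1.not_ge p.val_mem_Icc.2
    refine ⟨minus y hy01, ⟨rfl, by_contra fun hyK => ?_⟩, rfl⟩
    obtain ⟨z, ⟨p, ⟨hp, hpK⟩, hpz⟩, u, ⟨hu, huK⟩, huz⟩ :=
      (hy.and (eventually_mem_real (p := minus y hy01) hK.compl.isOpen ⟨rfl, hyK⟩)).exists
    exact huK (injOn_val_sheet true hp hu (hpz.trans huz.symm) ▸ hpK)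
  · rintro _ ⟨p, hp, rfl⟩
    exact eventually_mem_real hK.isOpen hp

end Real

end DArrow

end OrderedDynamics

namespace PMap

open OrderedDynamics

variable {X : Type*} [TopologicalSpace X] {S : PMap} {F : X ≃ₜ X} {v : X → ℝ} {Y R : Set X}
  {p : X} {y : ℝ} {n : ℕ}

/-- The partial map `S` is read off the homeomorphism `F` through the coordinate `v`, which is
injective on the `F`-invariant set `Y`: the points of `Y` are moved as `F` does as long as they stay
in `R`, outside of which `S` is not defined. -/
structure Models (S : PMap) (F : X ≃ₜ X) (v : X → ℝ) (Y R : Set X) : Prop where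
  injOn : InjOn v Y
  apply_mem_iff : ∀ p, F p ∈ Y ↔ p ∈ Y
  dom_eq : S.dom = v '' (Y ∩ R)
  toFun_apply : ∀ p ∈ Y, S.toFun (v p) = v (F p)

namespace Models

lemma val_mem_dom (h : S.Models F v Y R) (hp : p ∈ Y) : v p ∈ S.dom ↔ p ∈ R := by
  rw [h.dom_eq, h.injOn.mem_image_iff inter_subset_left hp]
  exact and_iff_right hp

lemma iterate_mem (h : S.Models F v Y R) (hp : p ∈ Y) (n : ℕ) : F^[n] p ∈ Y :=
  MapsTo.iterate (fun q => (h.apply_mem_iff q).2) n hp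

lemma symm_iterate_mem (h : S.Models F v Y R) (hp : p ∈ Y) (n : ℕ) : F.symm^[n] p ∈ Y :=
  MapsTo.iterate (fun q hq => (h.apply_mem_iff _).1 (by rwa [F.apply_symm_apply])) n hp

lemma isPeriodicPt_iff (h : S.Models F v Y R) (hp : p ∈ Y) :
    IsPeriodicPt F n p ↔ v (F^[n] p) = v p :=
  (h.injOn.eq_iff (h.iterate_mem hp n) hp).symm

lemma iterate_apply (h : S.Models F v Y R) (hp : p ∈ Y) (n : ℕ) :
    S.toFun^[n] (v p) = v (F^[n] p) := by
  induction n with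
  | zero => rfl
  | succ n ih => rw [iterate_succ_apply', iterate_succ_apply', ih,
      h.toFun_apply _ (h.iterate_mem hp n)]

lemma val_mem_domIter (h : S.Models F v Y R) (hp : p ∈ Y) :
    v p ∈ S.domIter n ↔ ∀ k < n, F^[k] p ∈ R :=
  forall₂_congr fun k _ => by rw [h.iterate_apply hp, h.val_mem_dom (h.iterate_mem hp k)]

lemma mem_domIter_and_iterate_eq (h : S.Models F v Y R) (hp : p ∈ Y) :
    y ∈ S.domIter n ∧ S.toFun^[n] y = v p ↔
      y = v (F.symm^[n] p) ∧ ∀ k < n, F.symm^[n - k] p ∈ R := by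
  have hback : v (F.symm^[n] p) ∈ S.domIter n ↔ ∀ k < n, F.symm^[n - k] p ∈ R := by
    rw [h.val_mem_domIter (h.symm_iterate_mem hp n)]
    exact forall₂_congr fun k hk => by
      rw [iterate_leftInverse_of_le F.apply_symm_apply hk.le]
  constructor
  · rintro ⟨hy, hyp⟩
    suffices heq : y = v (F.symm^[n] p) from ⟨heq, hback.1 (heq ▸ hy)⟩
    rcases n.eq_zero_or_pos with rfl | hn
    · exact hyp
    obtain ⟨u, ⟨huY, -⟩, rfl⟩ := h.dom_eq ▸ hy 0 hn
    rw [h.iterate_apply huY] at hyp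
    rw [← h.injOn (h.iterate_mem huY n) hp hyp, LeftInverse.iterate F.symm_apply_apply]
  · rintro ⟨rfl, hR⟩
    refine ⟨hback.2 hR, ?_⟩
    rw [h.iterate_apply (h.symm_iterate_mem hp n), LeftInverse.iterate F.apply_symm_apply]

lemma val_mem_range (h : S.Models F v Y R) (hp : p ∈ Y) : v p ∈ S.range ↔ F.symm p ∈ R := by
  have hback := fun y => h.mem_domIter_and_iterate_eq hp (n := 1) (y := y)
  simp only [domIter, Nat.lt_one_iff, forall_eq, iterate_zero_apply, Nat.sub_zero, iterate_one,
    mem_ofPred_eq] at hback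
  exact (exists_congr hback).trans exists_eq_left

lemma isTransient_iff (h : S.Models F v Y R) (hp : p ∈ Y) (hpR : p ∈ R) :
    S.IsTransient (v p) ↔ (∃ n, F^[n] p ∉ R) ∧ ∃ n, F.symm^[n] p ∉ R := by
  classical
  refine and_congr ?_ ?_
  · simp only [h.val_mem_domIter hp, h.iterate_apply hp, h.val_mem_dom (h.iterate_mem hp _)]
    exact ⟨fun ⟨n, hn⟩ => ⟨n, hn.2⟩, fun hex => ⟨Nat.find hex,
      fun k hk => not_not.1 (Nat.find_min hex hk), Nat.find_spec hex⟩⟩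
  · simp only [← and_assoc, h.mem_domIter_and_iterate_eq hp]
    constructor
    · rintro ⟨n, _, ⟨rfl, -⟩, hn⟩
      rw [h.val_mem_range (h.symm_iterate_mem hp n), ← iterate_succ_apply' F.symm] at hn
      exact ⟨n + 1, hn⟩
    · intro hex
      obtain ⟨n, hn⟩ := Nat.exists_eq_add_one_of_ne_zero fun h0 : Nat.find hex = 0 =>
        (Nat.find_eq_zero hex).1 h0 hpR
      refine ⟨n, _, ⟨rfl, fun k hk => not_not.1 (Nat.find_min hex (by omega))⟩, ?_⟩
      rw [h.val_mem_range (h.symm_iterate_mem hp n), ← iterate_succ_apply' F.symm,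
        Nat.succ_eq_add_one, ← hn]
      exact Nat.find_spec hex

lemma iterate_mem_of_forwardOrbit_subset (h : S.Models F v Y R) (hp : p ∈ Y)
    (hsub : S.forwardOrbit (v p) ⊆ S.dom) (n : ℕ) : F^[n] p ∈ R := by
  induction n using Nat.strong_induction_on with
  | _ n ih =>
    exact (h.val_mem_dom (h.iterate_mem hp n)).1
      (hsub ⟨n, (h.val_mem_domIter hp).2 ih, h.iterate_apply hp n⟩)

lemma symm_iterate_mem_of_backwardOrbit_subset (h : S.Models F v Y R) (hp : p ∈ Y)
    (hsub : S.backwardOrbit (v p) ⊆ S.range) (n : ℕ) : F.symm^[n + 1] p ∈ R := by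
  induction n using Nat.strong_induction_on with
  | _ n ih =>
    rw [iterate_succ_apply', ← h.val_mem_range (h.symm_iterate_mem hp n)]
    refine hsub ⟨n, (h.mem_domIter_and_iterate_eq hp).2 ⟨rfl, fun k hk => ?_⟩⟩
    simpa only [show n - k - 1 + 1 = n - k by omega] using ih (n - k - 1) (by omega)

lemma orbit_eq (h : S.Models F v Y R) (hp : p ∈ Y) (hf : ∀ n, F^[n] p ∈ R)
    (hb : ∀ n, F.symm^[n] p ∈ R) :
    S.orbit (v p) = v '' (Set.range (fun n => F^[n] p) ∪ Set.range fun n => F.symm^[n] p) := by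
  rw [image_union, ← range_comp, ← range_comp]
  refine congrArg₂ (· ∪ ·) ?_ ?_ <;> ext y
  · exact exists_congr fun n => by
      rw [and_iff_right ((h.val_mem_domIter hp).2 fun k _ => hf k), h.iterate_apply hp]
      rfl
  · exact exists_congr fun n => (h.mem_domIter_and_iterate_eq hp).trans
      ((and_iff_left fun k _ => hb (n - k)).trans eq_comm)

lemma orbit_subset (h : S.Models F v Y R) (hp : p ∈ Y) (hf : ∀ n, F^[n] p ∈ R)
    (hb : ∀ n, F.symm^[n] p ∈ R) : S.orbit (v p) ⊆ S.dom ∩ S.range := by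
  rw [h.orbit_eq hp hf hb]
  rintro _ ⟨_, ⟨n, rfl⟩ | ⟨n, rfl⟩, rfl⟩
  · refine ⟨(h.val_mem_dom (h.iterate_mem hp n)).2 (hf n),
      (h.val_mem_range (h.iterate_mem hp n)).2 ?_⟩
    cases n with
    | zero => exact hb 1
    | succ n => rw [iterate_succ_apply', F.symm_apply_apply]; exact hf n
  · refine ⟨(h.val_mem_dom (h.symm_iterate_mem hp n)).2 (hb n),
      (h.val_mem_range (h.symm_iterate_mem hp n)).2 ?_⟩
    rw [← iterate_succ_apply' F.symm]
    exact hb (n + 1)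

lemma mem_omegaLimit_iff (h : S.Models F v Y R) (hv : IsProperMap v) (hp : p ∈ Y)
    (hf : ∀ n, F^[n] p ∈ R) :
    v p ∈ S.omegaLimit (v p) ↔ ∃ q, v q = v p ∧ q ∈ omegaSet F p := by
  rw [exists_mem_omegaSet_iff hv, mapClusterPt_iff_frequently]
  simp only [frequently_atTop]
  refine (and_iff_right ((h.val_mem_dom hp).2 (hf 0))).trans (forall₃_congr fun U _ N => ?_)
  exact exists_congr fun n => and_congr_right fun _ => by
    rw [and_iff_right ((h.val_mem_domIter hp).2 fun k _ => hf k), h.iterate_apply hp]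

lemma mem_alphaLimit_iff (h : S.Models F v Y R) (hv : IsProperMap v) (hp : p ∈ Y)
    (hb : ∀ n, F.symm^[n] p ∈ R) :
    v p ∈ S.alphaLimit (v p) ↔ ∃ q, v q = v p ∧ q ∈ omegaSet F.symm p := by
  rw [exists_mem_omegaSet_iff hv, mapClusterPt_iff_frequently]
  simp only [frequently_atTop]
  refine (and_iff_right ((h.val_mem_dom hp).2 (hb 0))).trans (forall₃_congr fun U _ N => ?_)
  refine exists_congr fun n => and_congr_right fun _ => ?_
  simp only [h.mem_domIter_and_iterate_eq hp, and_iff_left fun k (_ : k < n) => hb (n - k)]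
  exact exists_eq_right

lemma isRecurrent_iff (h : S.Models F v Y R) (hv : IsProperMap v) (hp : p ∈ Y) :
    S.IsRecurrent (v p) ↔ ((∀ n, F^[n] p ∈ R) ∧ ∃ q, v q = v p ∧ q ∈ omegaSet F p) ∧
      (∀ n, F.symm^[n] p ∈ R) ∧ ∃ q, v q = v p ∧ q ∈ omegaSet F.symm p := by
  constructor
  · rintro ⟨⟨hfsub, hω⟩, hbsub, hα⟩
    have hf := h.iterate_mem_of_forwardOrbit_subset hp fun y hy => (hfsub hy).1
    have hb : ∀ n, F.symm^[n] p ∈ R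
      | 0 => hf 0
      | n + 1 => h.symm_iterate_mem_of_backwardOrbit_subset hp (fun y hy => (hbsub hy).2) n
    exact ⟨⟨hf, (h.mem_omegaLimit_iff hv hp hf).1 hω⟩, hb, (h.mem_alphaLimit_iff hv hp hb).1 hα⟩
  · rintro ⟨⟨hf, hω⟩, hb, hα⟩
    have hsub := union_subset_iff.1 (h.orbit_subset hp hf hb)
    exact ⟨⟨hsub.1, (h.mem_omegaLimit_iff hv hp hf).2 hω⟩, hsub.2,
      (h.mem_alphaLimit_iff hv hp hb).2 hα⟩

lemma isPeriodicOfPeriod (h : S.Models F v Y R) (hp : p ∈ Y) (hper : p ∈ periodicPts F)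
    (hf : ∀ n, F^[n] p ∈ R) : S.IsPeriodicOfPeriod (minimalPeriod F p) (v p) := by
  have hback : Set.range (fun n => F.symm^[n] p) ⊆ Set.range fun n => F^[n] p :=
    range_iterate_subset_of_leftInverse F.symm_apply_apply hper
  have hb : ∀ n, F.symm^[n] p ∈ R := fun n => range_subset_iff.2 hf (hback ⟨n, rfl⟩)
  have horbit : S.orbit (v p) = (fun n => v (F^[n] p)) '' Iio (minimalPeriod F p) := by
    rw [h.orbit_eq hp hf hb, union_eq_self_of_subset_right hback, range_iterate_eq_image_Iio hper,
      image_image]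
  have hinj : InjOn (fun n => v (F^[n] p)) (Iio (minimalPeriod F p)) :=
    h.injOn.comp iterate_injOn_Iio_minimalPeriod fun n _ => h.iterate_mem hp n
  refine ⟨⟨h.orbit_subset hp hf hb, horbit ▸ (finite_Iio _).image _⟩, ?_⟩
  rw [horbit, hinj.ncard_image, ← Finset.coe_Iio, ncard_coe_finset, Nat.card_Iio]

lemma not_isPeriodic (h : S.Models F v Y R) (hp : p ∈ Y) (hper : p ∉ periodicPts F)
    (hf : ∀ n, F^[n] p ∈ R) : ¬ S.IsPeriodic (v p) := fun hfin => by
  refine infinite_range_of_injective (f := fun n => v (F^[n] p)) (fun m n hmn => ?_)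
    (hfin.2.subset ?_)
  · exact iterate_injective_of_notMem_periodicPts F.injective hper
      (h.injOn (h.iterate_mem hp m) (h.iterate_mem hp n) hmn)
  · rintro _ ⟨n, rfl⟩
    exact .inl ⟨n, (h.val_mem_domIter hp).2 fun k _ => hf k, h.iterate_apply hp n⟩

end Models

lemma IsQuasiminimalType.not_isPeriodicType (hS : S.IsQuasiminimalType) :
    ¬ S.IsPeriodicType := by
  rintro ⟨q, -, hall⟩
  obtain ⟨⟨_, ⟨x, hx, -⟩, -⟩, -⟩ := hS
  exact hx.2 (hall x hx.1).1

end PMap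

namespace GGIET

open OrderedDynamics DArrow

variable {r : WithTop ℕ∞} {d : ℕ} {T : GGIET r d} {α : Fin d} {p : DArrow}

section Hat

lemma exists_branch (T : GGIET r d) (α : Fin d) : ∃ g : ℝ → ℝ,
    StrictMonoOn g (Icc (T.topL α) (T.topR α)) ∧
    SurjOn g (Icc (T.topL α) (T.topR α)) (Icc (T.botL α) (T.botR α)) ∧
    g (T.topL α) = T.botL α ∧ g (T.topR α) = T.botR α ∧
    ∀ s, EqOn (sideLim T.toFun s) g (halfOpen s (T.topL α) (T.topR α)) := by
  obtain ⟨g, h, hg, hh, hinv, hmono, hdiff, -, hfg⟩ := T.branch α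
  have hsurj := hinv.2.surjOn hh
  have hL := left_mem_Icc.2 (T.top_lt α).le
  have hR := right_mem_Icc.2 (T.top_lt α).le
  refine ⟨g, hmono, hsurj, le_antisymm ?_ (hg hL).1, le_antisymm (hg hR).2 ?_,
    fun s x hx => sideLim_eq hdiff.continuousOn hfg hx⟩
  · obtain ⟨x, hx, hgx⟩ := hsurj (left_mem_Icc.2 (T.bot_lt α).le)
    exact hgx ▸ hmono.monotoneOn hL hx hx.1
  · obtain ⟨x, hx, hgx⟩ := hsurj (right_mem_Icc.2 (T.bot_lt α).le)
    exact hgx ▸ hmono.monotoneOn hx hR hx.2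

lemma sideLim_mem_halfOpen (hp : p ∈ box (T.topL α) (T.topR α)) :
    sideLim T.toFun p.right p.val ∈ halfOpen p.right (T.botL α) (T.botR α) := by
  obtain ⟨g, hmono, -, hL, hR, hg⟩ := T.exists_branch α
  rw [hg p.right hp, ← hL, ← hR]
  exact (apply_mem_halfOpen_iff hmono (halfOpen_subset_Icc hp)).2 hp

lemma exists_mem_box_top (hT : T.IsGIET) (p : DArrow) : ∃ α, p ∈ box (T.topL α) (T.topR α) :=
  exists_mem_halfOpen hT.1.ge p.mem

lemma exists_mem_box_bot (hT : T.IsGIET) (p : DArrow) : ∃ α, p ∈ box (T.botL α) (T.botR α) :=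
  exists_mem_halfOpen hT.2.ge p.mem

/-- The map induced by a generalized interval exchange transformation on the double arrow space; it
acts on left copies through the left limits. -/
noncomputable def hatFun (hT : T.IsGIET) (p : DArrow) : DArrow where
  val := sideLim T.toFun p.right p.val
  right := p.right
  mem := by
    obtain ⟨α, hα⟩ := exists_mem_box_top hT p
    exact halfOpen_subset_halfOpen (T.bot_lt α) (T.bot_subset α) (sideLim_mem_halfOpen hα)

lemma strictMonoOn_hatFun (hT : T.IsGIET) (α : Fin d) :
    StrictMonoOn (hatFun hT) (box (T.topL α) (T.topR α)) := by
  obtain ⟨g, hmono, -, -, -, hg⟩ := T.exists_branch α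
  have hval : ∀ p ∈ box (T.topL α) (T.topR α), (hatFun hT p).val = g p.val := fun p hp =>
    hg p.right hp
  intro p hp u hu hpu
  rw [lt_iff, hval p hp, hval u hu]
  exact (lt_iff.1 hpu).imp (hmono (halfOpen_subset_Icc hp) (halfOpen_subset_Icc hu) ·)
    (And.imp_left (congrArg g))

lemma image_hatFun_box (hT : T.IsGIET) (α : Fin d) :
    hatFun hT '' box (T.topL α) (T.topR α) = box (T.botL α) (T.botR α) := by
  refine Subset.antisymm (image_subset_iff.2 fun p => sideLim_mem_halfOpen) fun u hu => ?_
  obtain ⟨g, hmono, hsurj, hL, hR, hg⟩ := T.exists_branch α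
  obtain ⟨x, hxI, hx⟩ := hsurj (halfOpen_subset_Icc hu)
  have hmem : x ∈ halfOpen u.right (T.topL α) (T.topR α) := by
    rwa [← apply_mem_halfOpen_iff hmono hxI, hL, hR, hx]
  exact ⟨⟨x, u.right, halfOpen_subset_halfOpen (T.top_lt α) (T.top_subset α) hmem⟩, hmem,
    DArrow.ext ((hg u.right hmem).trans hx) rfl⟩

lemma bijective_hatFun (hT : T.IsGIET) : Bijective (hatFun hT) := by
  constructor
  · intro p u hpu
    obtain ⟨α, hα⟩ := exists_mem_box_top hT p
    obtain ⟨β, hβ⟩ := exists_mem_box_top hT u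
    have hβ' : hatFun hT p ∈ box (T.botL β) (T.botR β) := by
      rw [hpu]
      exact sideLim_mem_halfOpen hβ
    obtain rfl : α = β := by_contra fun hne =>
      (disjoint_halfOpen (T.bot_disjoint hne)).ne_of_mem (sideLim_mem_halfOpen hα) hβ' rfl
    exact (strictMonoOn_hatFun hT α).injOn hα hβ hpu
  · intro u
    obtain ⟨α, hα⟩ := exists_mem_box_bot hT u
    exact image_subset_range _ _ ((image_hatFun_box hT α).ge hα)

lemma continuous_hatFun (hT : T.IsGIET) : Continuous (hatFun hT) := by
  refine continuous_iff_continuousAt.2 fun p => ?_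
  obtain ⟨α, hα⟩ := exists_mem_box_top hT p
  have : OrdConnected (box (T.topL α) (T.topR α)) :=
    ordConnected_box (T.top_lt α) (T.top_subset α)
  have : OrdConnected (hatFun hT '' box (T.topL α) (T.topR α)) :=
    image_hatFun_box hT α ▸ ordConnected_box (T.bot_lt α) (T.bot_subset α)
  exact (continuousOn_of_strictMonoOn (strictMonoOn_hatFun hT α)).continuousAt
    ((isClopen_box (T.top_lt α) (T.top_subset α)).isOpen.mem_nhds hα)

/-- The homeomorphism of the double arrow space induced by a generalized interval exchange
transformation. -/
noncomputable def hat (hT : T.IsGIET) : DArrow ≃ₜ DArrow :=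
  Continuous.homeoOfEquivCompactToT2 (f := Equiv.ofBijective _ (bijective_hatFun hT))
    (continuous_hatFun hT)

lemma isLocallyMonotone_hat (hT : T.IsGIET) : IsLocallyMonotone (hat hT) := fun p => by
  obtain ⟨α, hα⟩ := exists_mem_box_top hT p
  exact ⟨_, {
    isOpen := (isClopen_box (T.top_lt α) (T.top_subset α)).isOpen
    ordConnected := ordConnected_box (T.top_lt α) (T.top_subset α)
    strictMonoOn := strictMonoOn_hatFun hT α
    ordConnected_image :=
      image_hatFun_box hT α ▸ ordConnected_box (T.bot_lt α) (T.bot_subset α) }, hα⟩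

end Hat

section Restrictions

variable {hT : T.IsGIET} {K R C M : Set DArrow} {q : ℕ} {x : ℝ}

lemma mapsTo_hat_sheet (hT : T.IsGIET) (s : Bool) : MapsTo (hat hT) (sheet s) (sheet s) :=
  fun _ hp => hp

lemma mapsTo_symm_hat_sheet (hT : T.IsGIET) (s : Bool) :
    MapsTo (hat hT).symm (sheet s) (sheet s) := fun p hp =>
  (congrArg right ((hat hT).apply_symm_apply p)).trans hp

/-- The restriction of `T` to the set of the points whose right copies lie in `K`. -/
abbrev restrictTo (T : GGIET r d) (K : Set DArrow) : PMap := T.toPMap.restrict (real K)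

lemma models_restrictTo (hT : T.IsGIET) (K : Set DArrow) :
    (T.restrictTo K).Models (hat hT) val (sheet true) K where
  injOn := injOn_val_sheet true
  apply_mem_iff _ := Iff.rfl
  dom_eq := inter_eq_right.2 <| by
    rw [toPMap, hT.1, ← real_univ]
    exact image_mono (inter_subset_inter_right _ (subset_univ K))
  toFun_apply p hp := congrArg (fun s => sideLim T.toFun s p.val) hp.symm

lemma models_leftOpen (hT : T.IsGIET) (hK : IsClopen K) :
    (T.restrictTo K).leftOpen.Models (hat hT) val (sheet false) K where
  injOn := injOn_val_sheet false
  apply_mem_iff _ := Iff.rfl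
  dom_eq := by
    rw [← setOf_eventually_mem_real hK, PMap.leftOpen, (models_restrictTo hT K).dom_eq]
    rfl
  toFun_apply p hp := congrArg (fun s => sideLim T.toFun s p.val) hp.symm

lemma isDomainOfTransition (hf : ∀ p, ∃ n, (hat hT)^[n] p ∉ K)
    (hb : ∀ p, ∃ n, (hat hT).symm^[n] p ∉ K) : T.toPMap.IsDomainOfTransition (real K) := by
  rintro _ ⟨p, ⟨hp, hpK⟩, rfl⟩
  exact ((models_restrictTo hT K).isTransient_iff hp hpK).2 ⟨hf p, hb p⟩

lemma isDomainOfRecurrence (hR : IsRecurrenceRegion (hat hT) R C) :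
    T.toPMap.IsDomainOfRecurrence (real R) := by
  rintro _ ⟨p, ⟨hp, hpR⟩, rfl⟩ htrans
  obtain ⟨⟨n, hn⟩, m, hm⟩ := ((models_restrictTo hT R).isTransient_iff hp hpR).1 htrans
  exact (hR.stays p hpR).elim (fun h => hn (h.1 n)) fun h => hm (h.1 m)

lemma exists_of_isRecurrent (hT : T.IsGIET) (hx : (T.restrictTo R).IsRecurrent x) :
    ∃ p ∈ sheet true, val p = x ∧
      ((∀ n, (hat hT)^[n] p ∈ R) ∧ ∃ u, val u = val p ∧ u ∈ omegaSet (hat hT) p) ∧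
      (∀ n, (hat hT).symm^[n] p ∈ R) ∧ ∃ u, val u = val p ∧ u ∈ omegaSet (hat hT).symm p := by
  have hmodel := models_restrictTo hT R
  obtain ⟨p, ⟨hp, -⟩, rfl⟩ := hmodel.dom_eq ▸ hx.1.2.1
  exact ⟨p, hp, rfl, (hmodel.isRecurrent_iff continuous_val.isProperMap hp).1 hx⟩

section PeriodicDomains

lemma isPeriodicAtRightEndpoint (hK : IsClopen K) (hp : p ∈ sheet false)
    (hper : p ∈ periodicPts (hat hT)) (hf : ∀ n, (hat hT)^[n] p ∈ K) {n : ℕ}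
    (hn : (T.restrictTo K).IsRightEndpoint ((hat hT)^[n] p).val) :
    (T.restrictTo K).IsPeriodicAtRightEndpoint (minimalPeriod (hat hT) p) p.val :=
  have hmodel := models_leftOpen hT hK
  ⟨hmodel.isPeriodicOfPeriod hp hper hf, _,
    .inl ⟨n, (hmodel.val_mem_domIter hp).2 fun k _ => hf k, hmodel.iterate_apply hp n⟩, hn⟩

/-- A left copy whose orbit avoids the right end points moves together with the right copy of the
same point. -/
lemma isPeriodicOfPeriod_of_forall_not_isRightEndpoint (hK : IsClopen K) (hp : p ∈ sheet false)
    (hper : p ∈ periodicPts (hat hT)) (hf : ∀ n, (hat hT)^[n] p ∈ K)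
    (hend : ∀ n, ¬ (T.restrictTo K).IsRightEndpoint ((hat hT)^[n] p).val) :
    (T.restrictTo K).IsPeriodicOfPeriod (minimalPeriod (hat hT) p) p.val := by
  have hright := models_restrictTo hT K
  have hleft := models_leftOpen hT hK
  have hinner : ∀ n, (T.restrictTo K).dom ∈ 𝓝 ((hat hT)^[n] p).val ∧
      ContinuousAt T.toFun ((hat hT)^[n] p).val := fun n =>
    by_contra fun h => hend n ⟨(hleft.val_mem_dom (hleft.iterate_mem hp n)).2 (hf n), h⟩
  obtain ⟨u, ⟨hu, -⟩, hup⟩ := hright.dom_eq ▸ mem_of_mem_nhds (hinner 0).1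
  have hval : ∀ n, ((hat hT)^[n] u).val = ((hat hT)^[n] p).val := fun n => by
    induction n with
    | zero => exact hup
    | succ n ih =>
      rw [iterate_succ_apply', iterate_succ_apply',
        ← hright.toFun_apply _ (hright.iterate_mem hu n),
        ← hleft.toFun_apply _ (hleft.iterate_mem hp n), ih]
      exact (leftLim_eq_of_tendsto ((hinner n).2.tendsto.mono_left nhdsWithin_le_nhds)).symm
  have hperiod : minimalPeriod (hat hT) u = minimalPeriod (hat hT) p :=
    minimalPeriod_eq_minimalPeriod_iff.2 fun n => by
      rw [hright.isPeriodicPt_iff hu, hleft.isPeriodicPt_iff hp, hval]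
      exact Eq.congr_right hup
  have huK : ∀ n, (hat hT)^[n] u ∈ K := fun n =>
    (hright.val_mem_dom (hright.iterate_mem hu n)).1 (hval n ▸ mem_of_mem_nhds (hinner n).1)
  have huper : u ∈ periodicPts (hat hT) :=
    minimalPeriod_pos_iff_mem_periodicPts.1
      (hperiod ▸ minimalPeriod_pos_of_mem_periodicPts hper)
  have := hright.isPeriodicOfPeriod hu huper huK
  rwa [hperiod, show u.val = p.val from hup] at this

lemma exists_isPeriodicOfPeriod_or (hK : IsClopen K) (hper : p ∈ periodicPts (hat hT))
    (hf : ∀ n, (hat hT)^[n] p ∈ K) :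
    (∃ x, (T.restrictTo K).IsPeriodicOfPeriod (minimalPeriod (hat hT) p) x) ∨
      ∃ y, (T.restrictTo K).IsPeriodicAtRightEndpoint (minimalPeriod (hat hT) p) y := by
  rcases p.mem_sheet_false_or_true with hp | hp
  · by_cases hend : ∃ n, (T.restrictTo K).IsRightEndpoint ((hat hT)^[n] p).val
    · obtain ⟨n, hn⟩ := hend
      exact .inr ⟨_, isPeriodicAtRightEndpoint hK hp hper hf hn⟩
    · exact .inl ⟨_, isPeriodicOfPeriod_of_forall_not_isRightEndpoint hK hp hper hf
        (not_exists.1 hend)⟩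
  · exact .inl ⟨_, (models_restrictTo hT K).isPeriodicOfPeriod hp hper hf⟩

/-- If `u ≠ p ≠ w`, then `u` and `w` both are the other copy of `val p`. A point accumulating on a
periodic orbit in the past and in the future belongs to that orbit. -/
lemma eq_of_isPeriodicPt_of_mem_omegaSet {F : DArrow ≃ₜ DArrow} (hF : IsLocallyMonotone F)
    (hsheet : ∀ s, MapsTo F (sheet s) (sheet s)) {u w : DArrow} (hu : val u = val p)
    (hw : val w = val p) (hω : u ∈ omegaSet F p) (hα : w ∈ omegaSet F.symm p) (hq : 0 < q)
    (hper : IsPeriodicPt F q u) : u = p := by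
  by_contra hne
  have huα : u ∈ omegaSet F.symm p := by
    by_cases hwp : w = p
    · exact omegaSet_subset_of_forall_mem isClosed_omegaSet
        (fun n => (mapsTo_symm_omegaSet F.symm p).iterate n (hwp ▸ hα)) hω
    · suffices huw : u = w from huw ▸ hα
      have hright : ∀ {a b : DArrow}, a.val = b.val → (a = b ↔ a.right = b.right) := fun h =>
        ⟨congrArg right, DArrow.ext h⟩
      rw [hright hu] at hne
      rw [hright hw] at hwp
      exact (hright (hu.trans hw.symm)).2
        ((Bool.eq_not.2 hne).trans (Bool.eq_not.2 hwp).symm)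
  obtain ⟨n, hn⟩ := hF.exists_iterate_eq_of_mem_omegaSet hq hper hω huα
  exact hne (DArrow.ext hu (hn ▸ (hsheet p.right).iterate n rfl))

lemma isPeriodicType (hq : 0 < q)
    (hR : IsRecurrenceRegion (hat hT) R {p | minimalPeriod (hat hT) p = q})
    (hCR : {p | minimalPeriod (hat hT) p = q} ⊆ R)
    (hne : {p | minimalPeriod (hat hT) p = q}.Nonempty) : (T.restrictTo R).IsPeriodicType := by
  have hperiodic : ∀ {p}, minimalPeriod (hat hT) p = q →
      p ∈ periodicPts (hat hT) ∧ ∀ n, (hat hT)^[n] p ∈ R := fun {p} hp => by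
    have hper := minimalPeriod_pos_iff_mem_periodicPts.1 (hp ▸ hq)
    exact ⟨hper, fun n => hCR ((minimalPeriod_apply_iterate hper n).trans hp)⟩
  refine ⟨q, ?_, fun x hx => ?_⟩
  · obtain ⟨p, rfl⟩ := hne
    obtain ⟨hper, hf⟩ := hperiodic rfl
    exact exists_isPeriodicOfPeriod_or hR.isClopen hper hf
  · obtain ⟨p, hp, rfl, ⟨hf, u, hup, hu⟩, -, w, hwp, hw⟩ := exists_of_isRecurrent hT hx
    suffices hpq : minimalPeriod (hat hT) p = q by
      obtain ⟨hper, hf⟩ := hperiodic hpq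
      exact hpq ▸ (models_restrictTo hT R).isPeriodicOfPeriod hp hper hf
    have hpt : ∀ {a}, minimalPeriod (hat hT) a = q → IsPeriodicPt (hat hT) q a := fun h =>
      h ▸ isPeriodicPt_minimalPeriod _ _
    rcases hR.stays p (hf 0) with ⟨-, hsub⟩ | ⟨-, hsub⟩
    · rw [← eq_of_isPeriodicPt_of_mem_omegaSet (isLocallyMonotone_hat hT) (mapsTo_hat_sheet hT)
        hup hwp hu hw hq (hpt (hsub hu))]
      exact hsub hu
    · rw [← eq_of_isPeriodicPt_of_mem_omegaSet (isLocallyMonotone_hat hT).symm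
        (mapsTo_symm_hat_sheet hT) hwp hup hw hu hq
        (isPeriodicPt_of_leftInverse (hat hT).symm_apply_apply (hpt (hsub hw)))]
      exact hsub hw

end PeriodicDomains

section QuasiminimalDomains

lemma exists_mem_val_iterate_eq (hR : IsRecurrenceRegion (hat hT) R M)
    (hfol : FollowsLeft (hat hT) R M) (hp : p ∈ sheet true)
    (hω : (∀ n, (hat hT)^[n] p ∈ R) ∧ ∃ u, val u = val p ∧ u ∈ omegaSet (hat hT) p)
    (hα : (∀ n, (hat hT).symm^[n] p ∈ R) ∧ ∃ u, val u = val p ∧ u ∈ omegaSet (hat hT).symm p) :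
    ∃ u ∈ M, ∀ n, ((hat hT)^[n] u).val = ((hat hT)^[n] p).val ∧
      ((hat hT).symm^[n] u).val = ((hat hT).symm^[n] p).val := by
  by_cases hpM : p ∈ M
  · exact ⟨p, hpM, fun n => ⟨rfl, rfl⟩⟩
  obtain ⟨hf, w, hwp, hw⟩ := hω
  obtain ⟨hb, w', hwp', hw'⟩ := hα
  obtain ⟨u, huM, hup⟩ : ∃ u ∈ M, u.val = p.val :=
    (hR.stays p (hf 0)).elim (fun h => ⟨w, h.2 hw, hwp⟩) fun h => ⟨w', h.2 hw', hwp'⟩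
  have hu : u ∈ sheet false := u.mem_sheet_false_or_true.resolve_right fun hu =>
    hpM (injOn_val_sheet true hu hp hup ▸ huM)
  have hcovBy := hfol p u hf hb hpM huM (covBy_of_val_eq hu hp hup)
  exact ⟨u, huM, fun n => ⟨val_eq_of_covBy (hcovBy n).1, val_eq_of_covBy (hcovBy n).2⟩⟩

lemma closure_orbit_eq (hM : IsMinimalSet (hat hT) M) (hR : IsRecurrenceRegion (hat hT) R M)
    (hfol : FollowsLeft (hat hT) R M) (hx : (T.restrictTo R).IsRecurrent x) :
    closure ((T.restrictTo R).orbit x) = val '' M := by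
  obtain ⟨p, hp, rfl, hω, hα⟩ := exists_of_isRecurrent hT hx
  obtain ⟨u, huM, hu⟩ := exists_mem_val_iterate_eq hR hfol hp hω hα
  have himage : val '' (Set.range (fun n => (hat hT)^[n] p) ∪
        Set.range fun n => (hat hT).symm^[n] p) =
      val '' (Set.range (fun n => (hat hT)^[n] u) ∪ Set.range fun n => (hat hT).symm^[n] u) := by
    simp only [image_union, ← range_comp, comp_def, fun n => (hu n).1, fun n => (hu n).2]
  rw [(models_restrictTo hT R).orbit_eq hp hω.1 hα.1, himage,
    continuous_val.isClosedMap.closure_image_eq_of_continuous continuous_val,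
    hM.closure_orbit_eq huM]

lemma not_isPeriodic_of_isRecurrent (hM : IsAperiodicMinimal (hat hT) M)
    (hR : IsRecurrenceRegion (hat hT) R M) (hx : (T.restrictTo R).IsRecurrent x) :
    ¬ (T.restrictTo R).IsPeriodic x := by
  obtain ⟨p, hp, rfl, ⟨hf, -⟩, -⟩ := exists_of_isRecurrent hT hx
  exact (models_restrictTo hT R).not_isPeriodic hp (fun hper@⟨_, hn, hpt⟩ =>
    hM.notMem_periodicPts p (hR.mem_of_isPeriodicPt hn hpt (hf 0)) hper) hf

lemma isRecurrent_of_mem (hM : IsMinimalSet (hat hT) M) (hMR : M ⊆ R) (hpM : p ∈ M)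
    (hp : p ∈ sheet true) : (T.restrictTo R).IsRecurrent p.val :=
  ((models_restrictTo hT R).isRecurrent_iff continuous_val.isProperMap hp).2
    ⟨⟨fun n => hMR (hM.mapsTo.iterate n hpM),
      p, rfl, (hM.omegaSet_eq (hat hT).continuous hpM).ge hpM⟩,
    fun n => hMR (hM.mapsTo_symm.iterate n hpM),
      p, rfl, (hM.symm.omegaSet_eq (hat hT).symm.continuous hpM).ge hpM⟩

lemma exists_mem_sheet_true (hM : IsAperiodicMinimal (hat hT) M) : ∃ m ∈ M, m ∈ sheet true := by
  obtain ⟨m, hm, hleast⟩ :=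
    hM.isMinimalSet.isClosed.isCompact.exists_isLeast hM.isMinimalSet.nonempty
  refine ⟨m, hm, m.mem_sheet_false_or_true.resolve_left fun hleft => ?_⟩
  obtain ⟨y, ⟨hy, hyM⟩, hne⟩ := accPt_iff_nhds.1 (hM.preperfect (hat hT).continuous m hm) _
    ((isOpen_Iic hleft).mem_nhds self_mem_Iic)
  exact hne (le_antisymm hy (hleast hyM))

lemma isQuasiminimalType (hM : IsAperiodicMinimal (hat hT) M)
    (hR : IsRecurrenceRegion (hat hT) R M) (hMR : M ⊆ R) (hfol : FollowsLeft (hat hT) R M) :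
    (T.restrictTo R).IsQuasiminimalType := by
  have hclosure := fun x (hx : (T.restrictTo R).IsRecurrent x) =>
    closure_orbit_eq hM.isMinimalSet hR hfol hx
  have hnontrivial : ∀ x, (T.restrictTo R).IsRecurrent x →
      (T.restrictTo R).IsNontriviallyRecurrent x := fun x hx =>
    ⟨hx, not_isPeriodic_of_isRecurrent hM hR hx⟩
  obtain ⟨m, hmM, hm⟩ := exists_mem_sheet_true hM
  have hrec := isRecurrent_of_mem hM.isMinimalSet hMR hmM hm
  refine ⟨⟨_, ⟨m.val, hnontrivial _ hrec, rfl⟩, ?_⟩, hnontrivial⟩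
  rintro _ ⟨x, hx, rfl⟩
  rw [hclosure x hx.1, hclosure _ hrec]

end QuasiminimalDomains

lemma xor_isPeriodicType_isQuasiminimalType (hC : IsRecurrenceClass (hat hT) C)
    (hfol : IsAperiodicMinimal (hat hT) C → FollowsLeft (hat hT) R C)
    (hR : IsRecurrenceRegion (hat hT) R C) (hCR : C ⊆ R) :
    Xor (T.restrictTo R).IsPeriodicType (T.restrictTo R).IsQuasiminimalType := by
  cases hC with
  | periodic hq hne =>
    have hper := isPeriodicType hq hR hCR hne
    exact .inl ⟨hper, fun h => h.not_isPeriodicType hper⟩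
  | aperiodic hM =>
    have hqm := isQuasiminimalType hM hR hCR (hfol hM)
    exact .inr ⟨hqm, hqm.not_isPeriodicType⟩

end Restrictions

end GGIET

theorem theorem1p1 {r : WithTop ℕ∞} {d : ℕ} (T : GGIET r d) (hT : T.IsGIET) :
    ∃ (k : ℕ) (D : Set ℝ) (R : Fin k → Set ℝ),
      IsRightOpenUnion D ∧ (∀ i, IsRightOpenUnion (R i)) ∧
      D ∪ (⋃ i, R i) = Set.Ico 0 1 ∧
      (∀ i, Disjoint D (R i)) ∧
      (Pairwise fun i j => Disjoint (R i) (R j)) ∧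
      T.toPMap.IsDomainOfTransition D ∧
      ∀ i, T.toPMap.IsDomainOfRecurrence (R i) ∧
        Xor (T.toPMap.restrict (R i)).IsPeriodicType
          (T.toPMap.restrict (R i)).IsQuasiminimalType := by
  open OrderedDynamics DArrow GGIET in
  obtain ⟨k, C, R, hC, hfollows, hR, hCR, hdisj, hfuture, hpast⟩ :=
    (isLocallyMonotone_hat hT).exists_decomposition
  have hclopen : IsClopen (⋃ i, R i) := isClopen_iUnion_of_finite fun i => (hR i).isClopen
  refine ⟨k, real (⋃ i, R i)ᶜ, fun i => real (R i), isRightOpenUnion_real hclopen.compl,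
    fun i => isRightOpenUnion_real (hR i).isClopen, ?_, fun i => ?_, fun i j hij => ?_,
    ?_, fun i => ⟨isDomainOfRecurrence (hR i), ?_⟩⟩
  · rw [real_union_iUnion, compl_union_self, real_univ]
  · exact disjoint_real (disjoint_compl_left.mono_right (subset_iUnion R i))
  · exact disjoint_real (hdisj hij)
  · exact isDomainOfTransition (fun p => (hfuture p).imp fun _ => not_not.2)
      fun p => (hpast p).imp fun _ => not_not.2
  · exact xor_isPeriodicType_isQuasiminimalType (hC i) (hfollows i) (hR i) (hCR i)
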